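/- Let $p$ be a prime, $n\ge 1$, let $F$ be a field containing a primitive $p$th root of unity, and let $K/F$ be a Galois extension whose group $G=\langle\sigma\rangle$ is cyclic of order $p^n$. If $p=2$, suppose that either $n>1$ or $-1\in N_{K/F}(K^\times)$. For $0\le i\le n$ let $K_i$ be the intermediate field of $K/F$ with $[K_i:F]=p^i$, let $H_i=\mathrm{Gal}(K/K_i)$, and set $K_{-\infty}^\times=\{1\}$ and $p^{-\infty}=0$. Let $J=K^\times/K^{\times p}$, regarded as an $\mathbb{F}_p[G]$-module; write $[\gamma]\in J$ for the class of $\gamma\in K^\times$, $[f]_F\in F^\times/F^{\times p}$ for the class of $f\in F^\times$, and $[K_i^\times]=K_i^\times K^{\times p}/K^{\times p}\subseteq J$. Let $m=i(K/F)$ be the minimum of the set of those $i\in\{-\infty,0,1,\dots,n\}$ for which there is $\delta\in K^\times$ with $$[N_{K/F}(\delta)]_F\ne[1]_F\quad\text{and}\quad [\delta]^{\tau-1}\in[K_i^\times]\ \text{ for all }\tau\in G,$$ and call $\delta\in K^\times$ exceptional if it satisfies these two conditions for $i=m$. Let $\delta$ be any exceptional element of $K/F$. Then the $\mathbb{F}_p[G]$-module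 $J$ decomposes as a direct sum of submodules $$J=X\oplus Y,\qquad Y=Y_n\oplus Y_{n-1}\oplus\dots\oplus Y_0,$$ where 1. $X$ is the cyclic $\mathbb{F}_p[G]$-module generated by $[\delta]$, and $\dim_{\mathbb{F}_p}X=p^m+1$; 2. $Y_i$ is a direct sum of (possibly zero or infinitely many) cyclic $\mathbb{F}_p[G]$-modules of dimension $p^i$ over $\mathbb{F}_p$, for $0\le i\le n$; and 3. for $0\le i\le n-1$, $$[K_i^\times]=\begin{cases}X^{(\sigma-1)}\oplus Y^{H_i}, & m\le i,\\ X^{(\sigma-1)(\sigma^{p^i}-1)^{p^{m-i}-1}}\oplus Y^{H_i}, & i<m,\end{cases}$$ where $X^{a}$ denotes the image of $X$ under the action of $a\in\mathbb{F}_p[G]$, and $Y^{H_i}$ is the subspace of the elements of $Y$ fixed by $H_i$. -/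

import Mathlib

/-- The group `Kˣ / (Kˣ)^p` of `p`-th power classes of a field, written additively. -/
def PowerClasses (p : ℕ) (K : Type*) [Field K] : Type _ :=
  Additive (Kˣ ⧸ (powMonoidHom p : Kˣ →* Kˣ).range)

namespace PowerClasses

instance (p : ℕ) (K : Type*) [Field K] : AddCommGroup (PowerClasses p K) :=
  inferInstanceAs (AddCommGroup (Additive (Kˣ ⧸ (powMonoidHom p : Kˣ →* Kˣ).range)))

/-- The class `[γ]` of a nonzero element `γ`. -/
def mk (p : ℕ) {K : Type*} [Field K] (γ : Kˣ) : PowerClasses p K :=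
  Additive.ofMul (QuotientGroup.mk γ)

/-- The homomorphism `γ ↦ [γ]` from `Kˣ`, written additively, to the power classes. -/
def mkHom (p : ℕ) (K : Type*) [Field K] : Additive Kˣ →+ PowerClasses p K :=
  (QuotientGroup.mk' (powMonoidHom p : Kˣ →* Kˣ).range).toAdditive

theorem mkHom_apply (p : ℕ) {K : Type*} [Field K] (γ : Kˣ) :
    mkHom p K (Additive.ofMul γ) = mk p γ := rfl

theorem exists_mk {p : ℕ} {K : Type*} [Field K] (x : PowerClasses p K) :
    ∃ γ : Kˣ, mk p γ = x := by
  obtain ⟨γ, hγ⟩ := QuotientGroup.mk_surjective (Additive.toMul x)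
  exact ⟨γ, congrArg Additive.ofMul hγ⟩

theorem mk_eq_zero_iff {p : ℕ} {K : Type*} [Field K] (γ : Kˣ) :
    mk p γ = 0 ↔ ∃ c : Kˣ, c ^ p = γ :=
  QuotientGroup.eq_one_iff (N := (powMonoidHom p : Kˣ →* Kˣ).range) γ

theorem nsmul_eq_zero (p : ℕ) (K : Type*) [Field K] (x : PowerClasses p K) : p • x = 0 := by
  obtain ⟨γ, rfl⟩ := exists_mk x
  exact (mk_eq_zero_iff (γ ^ p)).2 ⟨γ, rfl⟩

/-- The power classes form a vector space over `𝔽_p`. -/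
instance (p : ℕ) (K : Type*) [Field K] : Module (ZMod p) (PowerClasses p K) :=
  AddCommGroup.zmodModule (nsmul_eq_zero p K)

/-- The endomorphism `[γ] ↦ [τ γ]` of the power classes. -/
def galMap (p : ℕ) (F K : Type*) [Field F] [Field K] [Algebra F K] (τ : K ≃ₐ[F] K) :
    PowerClasses p K →+ PowerClasses p K :=
  (QuotientGroup.map (powMonoidHom p : Kˣ →* Kˣ).range (powMonoidHom p : Kˣ →* Kˣ).range
    (Units.map (τ : K →* K)) (by
      rintro _ ⟨γ, rfl⟩
      exact ⟨Units.map (τ : K →* K) γ, by simp⟩)).toAdditive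

theorem galMap_mk (p : ℕ) {F K : Type*} [Field F] [Field K] [Algebra F K] (τ : K ≃ₐ[F] K)
    (γ : Kˣ) : galMap p F K τ (mk p γ) = mk p (Units.map (τ : K →* K) γ) := rfl

/-- The representation over `𝔽_p` of the group of automorphisms of `K/F` on the
power classes. -/
def galRep (p : ℕ) (F K : Type*) [Field F] [Field K] [Algebra F K] :
    Representation (ZMod p) (K ≃ₐ[F] K) (PowerClasses p K) where
  toFun τ := (galMap p F K τ).toZModLinearMap p
  map_one' := by
    ext x
    obtain ⟨γ, rfl⟩ := exists_mk x
    exact (galMap_mk p _ γ).trans (congrArg (mk p) (Units.ext rfl))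
  map_mul' τ υ := by
    ext x
    obtain ⟨γ, rfl⟩ := exists_mk x
    exact (galMap_mk p _ γ).trans (congrArg (mk p) (Units.ext rfl))

/-- The power classes as a module over the group algebra `𝔽_p[G]`, where `G` is the group of
automorphisms of `K/F`. -/
noncomputable instance (p : ℕ) (F K : Type*) [Field F] [Field K] [Algebra F K] :
    Module (MonoidAlgebra (ZMod p) (K ≃ₐ[F] K)) (PowerClasses p K) :=
  Module.compHom _ (galRep p F K).asAlgebraHom.toRingHom

theorem groupAlgebra_smul_def (p : ℕ) {F K : Type*} [Field F] [Field K] [Algebra F K]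
    (a : MonoidAlgebra (ZMod p) (K ≃ₐ[F] K)) (x : PowerClasses p K) :
    a • x = (galRep p F K).asAlgebraHom a x := rfl

theorem of_smul_mk (p : ℕ) {F K : Type*} [Field F] [Field K] [Algebra F K]
    (τ : K ≃ₐ[F] K) (γ : Kˣ) :
    MonoidAlgebra.of (ZMod p) (K ≃ₐ[F] K) τ • mk p γ = mk p (Units.map (τ : K →* K) γ) := by
  rw [groupAlgebra_smul_def, Representation.asAlgebraHom_of]
  rfl

instance (p : ℕ) (F K : Type*) [Field F] [Field K] [Algebra F K] :
    IsScalarTower (ZMod p) (MonoidAlgebra (ZMod p) (K ≃ₐ[F] K)) (PowerClasses p K) :=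
  ⟨fun c a x => by simp only [groupAlgebra_smul_def, map_smul, LinearMap.smul_apply]⟩

/-- The subgroup `[Eˣ] = Eˣ (Kˣ)^p / (Kˣ)^p` of classes of nonzero elements of an intermediate
field `E` of `K/F`. -/
def ofField (p : ℕ) {F K : Type*} [Field F] [Field K] [Algebra F K]
    (E : IntermediateField F K) : Submodule (ZMod p) (PowerClasses p K) :=
  AddSubgroup.toZModSubmodule p
    ((mkHom p K).comp (Units.map (E.val : E →* K)).toAdditive).range

theorem mem_ofField_iff {p : ℕ} {F K : Type*} [Field F] [Field K] [Algebra F K]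
    (E : IntermediateField F K) (x : PowerClasses p K) :
    x ∈ ofField p E ↔ ∃ e : Eˣ, mk p (Units.map (E.val : E →* K) e) = x := Iff.rfl

/-- The groups `[K_iˣ]` for a tower `K_0, K_1, …` of intermediate fields, with the convention
that `K_{-∞}ˣ` is the trivial group. Here `⊥` stands for `-∞`. -/
def ofTower (p : ℕ) {F K : Type*} [Field F] [Field K] [Algebra F K]
    (E : ℕ → IntermediateField F K) : WithBot ℕ → Submodule (ZMod p) (PowerClasses p K)
  | none => ⊥
  | some i => ofField p (E i)

/-- The class `[N_{K/F}(γ)]_F` of the norm of `γ`. -/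
noncomputable def normClass (p : ℕ) (F : Type*) {K : Type*} [Field F] [Field K] [Algebra F K]
    (γ : Kˣ) : PowerClasses p F :=
  mk p (Units.map (Algebra.norm F : K →* F) γ)

/-- The element `δ` has a norm that is not a `p`-th power in `F`, and `[δ]^(τ - 1)` lies in
`[K_iˣ]` for all automorphisms `τ` of `K/F`. -/
def IsAdmissible (p : ℕ) {F K : Type*} [Field F] [Field K] [Algebra F K]
    (E : ℕ → IntermediateField F K) (i : WithBot ℕ) (δ : Kˣ) : Prop :=
  normClass p F δ ≠ 0 ∧
    ∀ τ : K ≃ₐ[F] K, (MonoidAlgebra.of (ZMod p) (K ≃ₐ[F] K) τ - 1) • mk p δ ∈ ofTower p E i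

/-- The set of the `i ∈ {-∞, 0, …, n}` over which the minimum `i(K/F)` is taken. -/
def indexSet (p n : ℕ) {F K : Type*} [Field F] [Field K] [Algebra F K]
    (E : ℕ → IntermediateField F K) : Set (WithBot ℕ) :=
  {i | i ≤ (n : WithBot ℕ) ∧ ∃ δ : Kˣ, IsAdmissible p E i δ}

/-- The minimum `i(K/F)` exists as soon as some index is admissible. -/
theorem exists_isLeast_indexSet {p n : ℕ} {F K : Type*} [Field F] [Field K] [Algebra F K]
    {E : ℕ → IntermediateField F K} (h : (indexSet p n E).Nonempty) :
    ∃ m, IsLeast (indexSet p n E) m :=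
  ⟨_, WellFounded.min_mem wellFounded_lt _ h,
    fun _ hx => not_lt.1 (WellFounded.not_lt_min wellFounded_lt _ hx)⟩

/-- The element `δ` is an exceptional element of `K/F`: the pair of conditions on `δ` holds for
the minimal index `i(K/F)`. -/
def IsExceptional (p n : ℕ) {F K : Type*} [Field F] [Field K] [Algebra F K]
    (E : ℕ → IntermediateField F K) (δ : Kˣ) : Prop :=
  ∃ m, IsLeast (indexSet p n E) m ∧ IsAdmissible p E m δ

/-- `p ^ m` for `m ∈ {-∞, 0, 1, …}`, with the convention `p ^ (-∞) = 0`. -/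
def powBot (p : ℕ) : WithBot ℕ → ℕ
  | none => 0
  | some i => p ^ i

/-- The image `X^a` of a submodule `X` under the action of an element `a` of the group
algebra. -/
noncomputable def image {p : ℕ} {F K : Type*} [Field F] [Field K] [Algebra F K]
    (a : MonoidAlgebra (ZMod p) (K ≃ₐ[F] K))
    (X : Submodule (MonoidAlgebra (ZMod p) (K ≃ₐ[F] K)) (PowerClasses p K)) :
    Submodule (ZMod p) (PowerClasses p K) :=
  (X.restrictScalars (ZMod p)).map ((galRep p F K).asAlgebraHom a)

/-- The subspace `Y^H` of the elements of a submodule `Y` that are fixed by a group `H` of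
automorphisms. -/
def fixedPart {p : ℕ} {F K : Type*} [Field F] [Field K] [Algebra F K]
    (H : Subgroup (K ≃ₐ[F] K))
    (Y : Submodule (MonoidAlgebra (ZMod p) (K ≃ₐ[F] K)) (PowerClasses p K)) :
    Submodule (ZMod p) (PowerClasses p K) where
  carrier := {y | y ∈ Y ∧ ∀ τ ∈ H, galRep p F K τ y = y}
  zero_mem' := ⟨Y.zero_mem, fun _ _ => map_zero _⟩
  add_mem' := fun ha hb => ⟨Y.add_mem ha.1 hb.1, fun τ hτ => by
    rw [map_add, ha.2 τ hτ, hb.2 τ hτ]⟩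
  smul_mem' := fun c _ ha => ⟨(Y.restrictScalars (ZMod p)).smul_mem c ha.1, fun τ hτ => by
    rw [map_smul, ha.2 τ hτ]⟩

/-- `Y` is the (internal, possibly empty or infinite) direct sum of a family of cyclic
`𝔽_p[G]`-submodules, each of dimension `d` over `𝔽_p`. -/
def IsSumOfCyclics {p : ℕ} {F K : Type*} [Field F] [Field K] [Algebra F K] (d : ℕ)
    (Y : Submodule (MonoidAlgebra (ZMod p) (K ≃ₐ[F] K)) (PowerClasses p K)) : Prop :=
  ∃ S : Set (Submodule (MonoidAlgebra (ZMod p) (K ≃ₐ[F] K)) (PowerClasses p K)),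
    (∀ C ∈ S, (∃ x, C = Submodule.span (MonoidAlgebra (ZMod p) (K ≃ₐ[F] K)) {x}) ∧
      Module.finrank (ZMod p) C = d) ∧
    sSupIndep S ∧ sSup S = Y

end PowerClasses

/-! Let N = σ - 1 act on J. In characteristic p, N^(p^i) = σ^(p^i) - 1, so N is nilpotent, and a
decomposition of J into cyclic modules is a Jordan basis of N. It is built from a basis of the socle
ker N by lifting each socle vector to the top of a string.

The norm from K_i to F acts on J as N^(p^i - 1). So a class in U_i, the image in J of
N_{K_i/F}(K_iˣ), is the bottom of a string of length p^i generated by a class from K_i. The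
exceptional element gives one further string, of length p^m + 1, with bottom e = N^(p^m)[δ]. A basis
adapted to e and to U_0 ⊇ … ⊇ U_n yields independent strings. They span by two facts: for p^i ≤ l <
p^(i+1), N^l maps ker N^(l+1) into U_{i+1} + 𝔽_p e, with no e needed when l > p^m
(`exists_pow_smul_eq_add_nsmul_socle`); and e ∉ U_i for i > m (`socle_notMem_normImage`).

The arithmetic is Hilbert 90. If [a] is fixed by H_i with i < n, then (σ^(p^i) - 1)a = p b
additively, and N_{K/K_i}(b) is a p-th root of unity. It is trivial exactly when [a] ∈ [K_iˣ], and
exactly when N_{K/F}(a) is a p-th power in F. A nontrivial value makes ξ a norm from K to K_i, which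
for i ≤ m would produce an admissible element of index below m. Hence J^{H_i} = [K_iˣ] for i ≤ m,
while for m < i < n the class [δ] accounts for the one missing dimension.

Only Hilbert 90, the p-torsion and the condition at p = 2 enter, so the argument runs in an abstract
module satisfying `IsKummerTower`. Its scalars are ℤ[X] rather than 𝔽_p[X] because norms must be
computed in Kˣ, not just modulo p-th powers. -/

open Polynomial

/-! ### Linear algebra: Jordan strings of a nilpotent endomorphism. -/

section JordanStrings

variable {k V B : Type*} [Field k] [AddCommGroup V] [Module k V] (N : Module.End k V)
  (x : B → V) (l : B → ℕ)

/-- The vectors `N ^ j (x b)` for `j < l b`. -/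
def jordanString (z : Σ b, Fin (l b)) : V := (N ^ (z.2 : ℕ)) (x z.1)

variable {N x l}

theorem pow_apply_eq_zero_of_le {v : V} {a b : ℕ} (h : (N ^ a) v = 0) (hab : a ≤ b) :
    (N ^ b) v = 0 := by
  obtain ⟨c, rfl⟩ := Nat.exists_eq_add_of_le' hab
  rw [pow_add, Module.End.mul_apply, h, map_zero]

/-- Apply N^d to a relation, for d descending. Vectors less than d steps above the bottom die, those
higher already have coefficient zero, and those at height d become the independent bottoms. -/
theorem linearIndependent_jordanString (hx : ∀ b, (N ^ l b) (x b) = 0)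
    (hli : LinearIndependent k fun b => (N ^ (l b - 1)) (x b)) :
    LinearIndependent k (jordanString N x l) := by
  classical
  rw [linearIndependent_iff']
  intro s c hc
  have key : ∀ q d, d + q = s.sup (fun z => l z.1) →
      ∀ z ∈ s, d ≤ l z.1 - 1 - (z.2 : ℕ) → c z = 0 := by
    intro q
    induction q with
    | zero =>
      intro d hd z hz hdz
      have h1 : l z.1 ≤ s.sup (fun z => l z.1) := Finset.le_sup (f := fun z => l z.1) hz
      have := z.2.2
      omega
    | succ q ih =>
      intro d hd
      have h1 : ∑ z ∈ s, c z • (N ^ d) (jordanString N x l z) = 0 := by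
        have := congrArg (N ^ d) hc
        simpa only [map_sum, map_smul, map_zero] using this
      have h2 : ∑ z ∈ s with d = l z.1 - 1 - (z.2 : ℕ), c z • (N ^ (l z.1 - 1)) (x z.1) = 0 := by
        rw [← h1, Finset.sum_filter]
        refine Finset.sum_congr rfl fun z hz => ?_
        have hz2 := z.2.2
        rw [jordanString, ← Module.End.mul_apply, ← pow_add]
        split_ifs with h
        · congr 4; omega
        · rcases lt_or_gt_of_ne h with h | h
          · rw [ih (d + 1) (by omega) z hz (by omega), zero_smul]
          · rw [pow_apply_eq_zero_of_le (hx z.1) (by omega), smul_zero]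
      have hinj : Function.Injective
          fun z : {z : Σ b, Fin (l b) // d = l z.1 - 1 - (z.2 : ℕ)} => z.1.1 := by
        rintro ⟨⟨b, j⟩, h⟩ ⟨⟨b', j'⟩, h'⟩ (rfl : b = b')
        have : j = j' := Fin.ext (by have := j.2; have := j'.2; simp only at h h'; omega)
        subst this; rfl
      have h3 : LinearIndepOn k (fun z : Σ b, Fin (l b) => (N ^ (l z.1 - 1)) (x z.1))
          {z | d = l z.1 - 1 - (z.2 : ℕ)} := hli.comp _ hinj
      have h4 := linearIndepOn_iff'.1 h3 _ c (by
        intro z hz; exact (Finset.mem_filter.1 hz).2) h2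
      intro z hz hdz
      rcases hdz.eq_or_lt with h | h
      · exact h4 z (Finset.mem_filter.2 ⟨hz, h⟩)
      · exact ih (d + 1) (by omega) z hz h
  exact fun z hz => key _ 0 (zero_add _) z hz (Nat.zero_le _)

/-- Induct on the power of N killing v. A bottom of a string longer than r can be lifted r steps, so
N^r v = N^r y with y in the span of the strings, and v - y is killed by a smaller power. -/
theorem span_jordanString_eq_top {q : ℕ} (hN : N ^ q = 0)
    (h : ∀ (r : ℕ) (v : V), (N ^ (r + 1)) v = 0 →
      (N ^ r) v ∈ Submodule.span k {w | ∃ b, r < l b ∧ w = (N ^ (l b - 1)) (x b)}) :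
    Submodule.span k (Set.range (jordanString N x l)) = ⊤ := by
  have key : ∀ (r : ℕ) (v : V), (N ^ r) v = 0 →
      v ∈ Submodule.span k (Set.range (jordanString N x l)) := by
    intro r
    induction r with
    | zero => intro v hv; simp at hv; simp [hv]
    | succ r ih =>
      intro v hv
      have h1 : Submodule.span k {w | ∃ b, r < l b ∧ w = (N ^ (l b - 1)) (x b)} ≤
          (Submodule.span k (Set.range (jordanString N x l))).map (N ^ r) := by
        rw [Submodule.span_le]
        rintro _ ⟨b, hb, rfl⟩
        refine ⟨(N ^ (l b - 1 - r)) (x b), Submodule.subset_span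
          ⟨⟨b, ⟨l b - 1 - r, by omega⟩⟩, rfl⟩, ?_⟩
        rw [← Module.End.mul_apply, ← pow_add]
        congr 2; omega
      obtain ⟨y, hy, hyv⟩ := h1 (h r v hv)
      have := ih (v - y) (by rw [map_sub, hyv, sub_self])
      simpa using Submodule.add_mem _ this hy
  exact eq_top_iff.2 fun v _ => key q v (by rw [hN]; rfl)

/-- N^d moves each string vector d steps down: the last d vectors of a string die, and the others go
injectively to string vectors. So N^d is injective on the span of the others. -/
theorem mem_span_jordanString_of_pow_apply_eq_zero
    (hx : ∀ b, (N ^ l b) (x b) = 0) (hli : LinearIndependent k (jordanString N x l))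
    {P : Set B} {d : ℕ} {y : V}
    (hy : y ∈ Submodule.span k (jordanString N x l '' {z | z.1 ∈ P})) (hd : (N ^ d) y = 0) :
    y ∈ Submodule.span k (jordanString N x l '' {z | z.1 ∈ P ∧ l z.1 ≤ z.2 + d}) := by
  have hsplit : {z : Σ b, Fin (l b) | z.1 ∈ P} =
      {z | z.1 ∈ P ∧ l z.1 ≤ z.2 + d} ∪ {z | z.1 ∈ P ∧ z.2 + d < l z.1} := by
    ext z
    have := le_or_gt (l z.1) (z.2 + d)
    simp only [Set.mem_ofPred_eq, Set.mem_union]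
    tauto
  rw [hsplit, Set.image_union, Submodule.span_union] at hy
  obtain ⟨y₁, h₁, y₂, h₂, rfl⟩ := Submodule.mem_sup.1 hy
  have hk : (N ^ d) y₁ = 0 := by
    suffices Submodule.span k (jordanString N x l '' {z | z.1 ∈ P ∧ l z.1 ≤ z.2 + d}) ≤
      LinearMap.ker (N ^ d) from this h₁
    rw [Submodule.span_le]
    rintro _ ⟨z, ⟨-, hz⟩, rfl⟩
    rw [SetLike.mem_coe, LinearMap.mem_ker, jordanString, ← Module.End.mul_apply, ← pow_add]
    exact pow_apply_eq_zero_of_le (hx z.1) (by omega)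
  rw [map_add, hk, zero_add] at hd
  let sh : {z : Σ b, Fin (l b) | z.1 ∈ P ∧ z.2 + d < l z.1} → Σ b, Fin (l b) :=
    fun z => ⟨z.1.1, ⟨z.1.2 + d, z.2.2⟩⟩
  have hsh : Function.Injective sh := by
    rintro ⟨⟨b, j⟩, h⟩ ⟨⟨b', j'⟩, h'⟩ he
    simp only [sh, Sigma.mk.injEq] at he
    obtain ⟨rfl, he⟩ := he
    have : j = j' := by
      have := congrArg Fin.val (eq_of_heq he)
      exact Fin.ext (by simpa using this)
    subst this; rfl
  have hli2 : LinearIndependent k ((N ^ d) ∘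
      fun z : {z : Σ b, Fin (l b) | z.1 ∈ P ∧ z.2 + d < l z.1} => jordanString N x l z) := by
    convert hli.comp sh hsh using 1
    ext z
    simp only [Function.comp, jordanString, sh]
    rw [← Module.End.mul_apply, ← pow_add, add_comm]
  have hdis := Submodule.range_ker_disjoint hli2
  have : y₂ = 0 := by
    refine Submodule.disjoint_def.1 hdis y₂ ?_ hd
    convert h₂ using 2
    ext w; simp
  rw [this, add_zero]
  exact h₁

/-- A basis adapted to a vector `e` and a finite decreasing filtration. -/
theorem exists_adapted_linearIndepOn (n : ℕ) (U : ℕ → Submodule k V)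
    {e : V} (he : e ≠ 0) :
    ∃ (S : Set V) (lv : V → ℕ), LinearIndepOn k id S ∧ e ∈ S ∧
      (∀ v ∈ S, v ≠ e → lv v < n ∧ v ∈ U (lv v)) ∧
      ∀ i < n, U i ≤ Submodule.span k (insert e {v | v ∈ S ∧ v ≠ e ∧ i ≤ lv v}) := by
  classical
  induction n generalizing U with
  | zero =>
    exact ⟨{e}, fun _ => 0, (linearIndepOn_singleton_iff k (v := id)).2 he, rfl, by simp_all, by simp⟩
  | succ n ih =>
    -- The deeper steps of the filtration are treated first, so the later extension only adds
    -- vectors of level 0.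
    obtain ⟨S, lv, hS, heS, hlv, hsp⟩ := ih (fun i => U (i + 1))
    obtain ⟨S', hS'1, hS'2, hS'3, hS'4⟩ := exists_linearIndepOn_id_extension hS
      (Set.subset_union_left (s := S) (t := (U 0 : Set V)))
    refine ⟨S', fun v => if v ∈ S then lv v + 1 else 0, hS'4, hS'2 heS, ?_, ?_⟩
    · intro v hv hve
      by_cases h : v ∈ S
      · simp only [h, if_true]
        have := hlv v h hve
        exact ⟨by omega, this.2⟩
      · simp only [h, if_false]
        exact ⟨by omega, (hS'1 hv).resolve_left h⟩
    · rintro (_ | i) hi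
      · intro u hu
        refine Submodule.span_mono ?_ (hS'3 (Or.inr hu))
        intro v hv
        by_cases h : v = e
        · exact Or.inl h
        · exact Or.inr ⟨hv, h, Nat.zero_le _⟩
      · refine (hsp i (by omega)).trans (Submodule.span_mono ?_)
        apply Set.insert_subset_insert
        rintro v ⟨h1, h2, h3⟩
        exact ⟨hS'2 h1, h2, by simp only [h1, if_true]; omega⟩

end JordanStrings

/-! ### Norm polynomials and their reduction modulo p. -/

/-- The norm polynomial from level `i` to level `j` of a cyclic tower of degree `p`. -/
noncomputable def normPoly (p i j : ℕ) : ℤ[X] :=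
  ∑ s ∈ Finset.range (p ^ (i - j)), (X ^ p ^ j) ^ s

namespace normPoly

variable {p i j k : ℕ}

theorem mul_X_pow_sub_one (h : j ≤ i) :
    normPoly p i j * (X ^ p ^ j - 1) = X ^ p ^ i - 1 := by
  rw [normPoly, geom_sum_mul, ← pow_mul, ← pow_add, Nat.add_sub_cancel' h]

theorem X_pow_sub_one_ne_zero {R : Type*} [CommRing R] [Nontrivial R] (hp : p.Prime) :
    (X ^ p ^ k - 1 : R[X]) ≠ 0 :=
  (monic_X_pow_sub_C (1 : R) (pow_pos hp.pos k).ne').ne_zero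

theorem self (p i : ℕ) : normPoly p i i = 1 := by simp [normPoly]

theorem mul_normPoly (hp : p.Prime) (hij : j ≤ i) (hjk : k ≤ j) :
    normPoly p j k * normPoly p i j = normPoly p i k := by
  apply mul_right_cancel₀ (X_pow_sub_one_ne_zero (k := k) hp)
  rw [mul_X_pow_sub_one (hjk.trans hij), ← mul_X_pow_sub_one hij, ← mul_X_pow_sub_one hjk]
  ring

theorem mul_X_sub_one (p i : ℕ) : normPoly p i 0 * (X - 1) = X ^ p ^ i - 1 := by
  rw [← mul_X_pow_sub_one (Nat.zero_le i), pow_zero, pow_one]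

/-- Both sides times X^(p^j) - 1 = (X - 1)^(p^j) agree modulo p. This is why the norm from K_i to
K_j acts on J as N^(p^i - p^j). -/
theorem map_zmod [Fact p.Prime] (h : j ≤ i) :
    (normPoly p i j).map (Int.castRingHom (ZMod p)) =
      ((X - 1 : ℤ[X]) ^ (p ^ i - p ^ j)).map (Int.castRingHom (ZMod p)) := by
  apply mul_right_cancel₀ (X_pow_sub_one_ne_zero (R := ZMod p) (k := j) (Fact.out : p.Prime))
  have h1 := congrArg (Polynomial.map (Int.castRingHom (ZMod p))) (mul_X_pow_sub_one (p := p) h)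
  have h2 : ∀ r, (X ^ p ^ r - 1 : (ZMod p)[X]) = (X - 1) ^ p ^ r := fun r => by
    rw [sub_pow_char_pow, one_pow]
  simp only [Polynomial.map_mul, Polynomial.map_sub, Polynomial.map_pow, Polynomial.map_X,
    Polynomial.map_one] at h1 ⊢
  rw [h1, h2, h2, ← pow_add, Nat.sub_add_cancel (Nat.pow_le_pow_right (Fact.out : p.Prime).pos h)]

/-- The coefficient in the expansion `normPoly = p ^ (i - j) + (X ^ p ^ j - 1) * _`. -/
noncomputable def remainder (p i j : ℕ) : ℤ[X] :=
  ∑ s ∈ Finset.range (p ^ (i - j)), ∑ r ∈ Finset.range s, (X ^ p ^ j) ^ r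

theorem eq_add_remainder (p i j : ℕ) :
    normPoly p i j = (p : ℤ[X]) ^ (i - j) + remainder p i j * (X ^ p ^ j - 1) := by
  rw [remainder, Finset.sum_mul, Finset.sum_congr rfl fun s _ => geom_sum_mul _ _,
    Finset.sum_sub_distrib, normPoly]
  simp

end normPoly

section Reduction

variable {p : ℕ} {J : Type*} [AddCommGroup J] [Module ℤ[X] J]

theorem smul_eq_smul_of_map_eq (hJ : ∀ y : J, p • y = 0) {f g : ℤ[X]}
    (h : f.map (Int.castRingHom (ZMod p)) = g.map (Int.castRingHom (ZMod p))) (y : J) :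
    f • y = g • y := by
  have h1 : C (p : ℤ) ∣ f - g := by
    rw [C_dvd_iff_dvd_coeff]
    intro i
    have := congrArg (fun q => q.coeff i) h
    simp only [coeff_map, eq_intCast] at this
    rw [← CharP.intCast_eq_zero_iff (ZMod p) p, coeff_sub, Int.cast_sub, this, sub_self]
  obtain ⟨c, hc⟩ := h1
  rw [← sub_eq_zero, ← sub_smul, hc, mul_comm, mul_smul]
  have : (C (p : ℤ) : ℤ[X]) • y = p • y := by
    rw [← Nat.cast_smul_eq_nsmul ℤ[X]]; simp
  rw [this, hJ, smul_zero]

theorem X_pow_sub_one_smul [Fact p.Prime] (hJ : ∀ y : J, p • y = 0) (i : ℕ) (y : J) :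
    (X ^ p ^ i - 1 : ℤ[X]) • y = (X - 1 : ℤ[X]) ^ p ^ i • y := by
  apply smul_eq_smul_of_map_eq hJ
  simp [sub_pow_char_pow]

theorem normPoly_smul [Fact p.Prime] (hJ : ∀ y : J, p • y = 0) {i j : ℕ} (h : j ≤ i) (y : J) :
    normPoly p i j • y = (X - 1 : ℤ[X]) ^ (p ^ i - p ^ j) • y :=
  smul_eq_smul_of_map_eq hJ (normPoly.map_zmod h) y

theorem normPoly_zero_smul [Fact p.Prime] (hJ : ∀ y : J, p • y = 0) (i : ℕ) (y : J) :
    normPoly p i 0 • y = (X - 1 : ℤ[X]) ^ (p ^ i - 1) • y := by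
  rw [normPoly_smul hJ (Nat.zero_le i), pow_zero]

end Reduction

/-! ### Abstract Kummer towers and consequences of Hilbert 90. -/

/-- The elements at level `i`: those fixed by the action of `X ^ p ^ i`. -/
noncomputable def levelSubmodule (p : ℕ) (A : Type*) [AddCommGroup A] [Module ℤ[X] A] (i : ℕ) :
    Submodule ℤ[X] A :=
  LinearMap.ker (LinearMap.lsmul ℤ[X] A (X ^ p ^ i - 1))

/-- The axioms satisfied by the multiplicative group of a cyclic extension of degree `p ^ n`
containing a primitive `p`-th root of unity `ξ`, written additively, where `X` acts as a generator
of the Galois group. -/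
structure IsKummerTower (p n : ℕ) {A : Type*} [AddCommGroup A] [Module ℤ[X] A] (ξ : A) :
    Prop where
  pos : 1 ≤ n
  mem_top : ∀ a, a ∈ levelSubmodule p A n
  hilbert90 : ∀ i j, j ≤ i → i ≤ n → ∀ a ∈ levelSubmodule p A i, normPoly p i j • a = 0 →
    ∃ b ∈ levelSubmodule p A i, (X ^ p ^ j - 1 : ℤ[X]) • b = a
  root_ne_zero : ξ ≠ 0
  nsmul_root : p • ξ = 0
  X_smul_root : (X - 1 : ℤ[X]) • ξ = 0
  torsion : ∀ a : A, p • a = 0 → ∃ c : ℕ, a = c • ξ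
  even : p = 2 → 1 < n ∨ ∃ x, normPoly p n 0 • x = ξ

section Level

variable {p n i j : ℕ} {A : Type*} [AddCommGroup A] [Module ℤ[X] A]

theorem mem_levelSubmodule {a : A} :
    a ∈ levelSubmodule p A i ↔ (X ^ p ^ i - 1 : ℤ[X]) • a = 0 := Iff.rfl

theorem mem_levelSubmodule_zero {a : A} :
    a ∈ levelSubmodule p A 0 ↔ (X - 1 : ℤ[X]) • a = 0 := by
  rw [mem_levelSubmodule, pow_zero, pow_one]

theorem levelSubmodule_mono (h : j ≤ i) : levelSubmodule p A j ≤ levelSubmodule p A i := by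
  intro a ha
  rw [mem_levelSubmodule] at ha ⊢
  rw [← normPoly.mul_X_pow_sub_one h, mul_smul, ha, smul_zero]

theorem normPoly_smul_mem (h : j ≤ i) {a : A} (ha : a ∈ levelSubmodule p A i) :
    normPoly p i j • a ∈ levelSubmodule p A j := by
  rw [mem_levelSubmodule] at ha ⊢
  rw [smul_smul, mul_comm, normPoly.mul_X_pow_sub_one h, ha]

theorem normPoly_smul_eq_nsmul {a : A} (ha : a ∈ levelSubmodule p A j) (i : ℕ) :
    normPoly p i j • a = p ^ (i - j) • a := by
  rw [mem_levelSubmodule] at ha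
  rw [normPoly.eq_add_remainder, add_smul, mul_smul, ha, smul_zero, add_zero,
    ← Nat.cast_smul_eq_nsmul ℤ[X], Nat.cast_pow]

theorem smul_nsmul_comm (f : ℤ[X]) (m : ℕ) (a : A) : f • m • a = m • f • a := by
  rw [← Nat.cast_smul_eq_nsmul ℤ[X], ← Nat.cast_smul_eq_nsmul ℤ[X], smul_comm]

end Level

namespace IsKummerTower

variable {p n : ℕ} [hp : Fact p.Prime] {A : Type*} [AddCommGroup A] [Module ℤ[X] A] {ξ : A}
  (h : IsKummerTower p n ξ)

include h

omit hp in
theorem root_mem (i : ℕ) : ξ ∈ levelSubmodule p A i :=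
  levelSubmodule_mono (Nat.zero_le i) (mem_levelSubmodule_zero.2 h.X_smul_root)

/-- Since (X - 1)a has trivial norm to level j, it is (X^(p^j) - 1)b, which equals (X - 1) applied
to `normPoly p j 0 • b`. The difference g = a - `normPoly p j 0 • b` is therefore at level 0; take
norms. -/
theorem exists_of_normPoly_smul_mem {i j : ℕ} (hji : j ≤ i) (hi : i ≤ n) {a : A}
    (ha : a ∈ levelSubmodule p A i) (hf : normPoly p i j • a ∈ levelSubmodule p A 0) :
    ∃ g ∈ levelSubmodule p A 0, ∃ b ∈ levelSubmodule p A i,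
      normPoly p i j • a = p ^ (i - j) • g + normPoly p i 0 • b := by
  rw [mem_levelSubmodule_zero] at hf
  obtain ⟨b, hb, hba⟩ := h.hilbert90 i j hji hi ((X - 1 : ℤ[X]) • a)
    (Submodule.smul_mem _ _ ha) (by rw [smul_comm, hf])
  refine ⟨a - normPoly p j 0 • b, ?_, b, hb, ?_⟩
  · rw [mem_levelSubmodule_zero, smul_sub, smul_smul, mul_comm (X - 1 : ℤ[X]),
      normPoly.mul_X_sub_one, hba, sub_self]
  · have h0 : a - normPoly p j 0 • b ∈ levelSubmodule p A 0 := by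
      rw [mem_levelSubmodule_zero, smul_sub, smul_smul, mul_comm (X - 1 : ℤ[X]),
        normPoly.mul_X_sub_one, hba, sub_self]
    rw [← normPoly_smul_eq_nsmul (levelSubmodule_mono (Nat.zero_le j) h0) i, smul_sub,
      smul_smul, mul_comm, normPoly.mul_normPoly hp.out hji (Nat.zero_le j)]
    abel

/-- The element `normPoly p j 0 • b - g` has trivial norm to level j. Hilbert 90 then lets b be
corrected by a multiple of X - 1 until `normPoly p j 0` sends it to g, and this forces it to level
j. -/
theorem exists_normPoly_smul_eq_of_nsmul {j : ℕ} (hj : j ≤ n) {g b : A}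
    (hg : g ∈ levelSubmodule p A 0) (hb : p ^ (n - j) • g = normPoly p n 0 • b) :
    ∃ c ∈ levelSubmodule p A j, normPoly p j 0 • c = g := by
  have hg' := levelSubmodule_mono (p := p) (Nat.zero_le j) hg
  obtain ⟨c, -, hc⟩ := h.hilbert90 n j hj le_rfl (normPoly p j 0 • b - g) (h.mem_top _) (by
    rw [smul_sub, normPoly_smul_eq_nsmul hg', hb, smul_smul, mul_comm,
      normPoly.mul_normPoly hp.out hj (Nat.zero_le j), sub_self])
  have h1 : normPoly p j 0 • (b - (X - 1 : ℤ[X]) • c) = g := by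
    rw [smul_sub, smul_smul, normPoly.mul_X_sub_one, hc]; abel
  refine ⟨b - (X - 1 : ℤ[X]) • c, ?_, h1⟩
  rw [mem_levelSubmodule, ← normPoly.mul_X_sub_one, mul_comm, mul_smul, h1]
  exact mem_levelSubmodule_zero.1 hg

theorem exists_normPoly_smul_eq_root {i : ℕ} (hi : i < n) :
    ∃ c ∈ levelSubmodule p A i, normPoly p i 0 • c = ξ := by
  -- Since n - i ≥ 1 and p kills ξ, the multiple p^(n-i) ξ is the norm of 0.
  refine h.exists_normPoly_smul_eq_of_nsmul hi.le (b := 0) (h.root_mem 0) ?_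
  obtain ⟨r, hr⟩ := Nat.exists_eq_add_of_lt hi
  rw [show n - i = r + 1 by omega, pow_succ, mul_smul, h.nsmul_root, smul_zero, smul_zero]

theorem exists_nsmul_nsmul_root {c : ℕ} (hc : c • ξ ≠ 0) : ∃ d : ℕ, d • c • ξ = ξ := by
  have hcop : Nat.Coprime c p := by
    rw [Nat.coprime_comm, hp.out.coprime_iff_not_dvd]
    rintro ⟨r, rfl⟩
    exact hc (by rw [mul_comm, mul_smul, h.nsmul_root, smul_zero])
  obtain ⟨d, -, hd⟩ := Nat.exists_mul_mod_eq_one_of_coprime hcop hp.out.one_lt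
  refine ⟨d, ?_⟩
  rw [smul_smul, mul_comm, ← Nat.mod_add_div (c * d) p, hd, add_smul, one_smul, mul_comm p,
    mul_smul, h.nsmul_root, smul_zero, add_zero]

end IsKummerTower

/-! ### Fixed classes, norm classes and construction of admissible elements. -/

/-- The elements whose norm to level `0` is `p` times an element of level `0`. -/
noncomputable def trivialNormSubmodule (p n : ℕ) (A : Type*) [AddCommGroup A] [Module ℤ[X] A] :
    Submodule ℤ[X] A :=
  ((levelSubmodule p A 0).map (LinearMap.lsmul ℤ[X] A (p : ℤ[X]))).comap
    (LinearMap.lsmul ℤ[X] A (normPoly p n 0))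

theorem mem_trivialNormSubmodule {p n : ℕ} {A : Type*} [AddCommGroup A] [Module ℤ[X] A] {a : A} :
    a ∈ trivialNormSubmodule p n A ↔
      ∃ f ∈ levelSubmodule p A 0, p • f = normPoly p n 0 • a := by
  simp only [trivialNormSubmodule, Submodule.mem_comap, Submodule.mem_map, LinearMap.lsmul_apply,
    Nat.cast_smul_eq_nsmul]

/-- `π` is the reduction modulo `p`. -/
structure IsModP (p : ℕ) {A J : Type*} [AddCommGroup A] [Module ℤ[X] A] [AddCommGroup J]
    [Module ℤ[X] J] (π : A →ₗ[ℤ[X]] J) : Prop where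
  surjective : Function.Surjective π
  eq_zero_iff : ∀ a, π a = 0 ↔ ∃ b, p • b = a

/-- The image in `J` of the elements of level `i`, for `i ∈ {-∞, 0, 1, …}`. -/
noncomputable def levelImage (p : ℕ) {A J : Type*} [AddCommGroup A] [Module ℤ[X] A]
    [AddCommGroup J] [Module ℤ[X] J] (π : A →ₗ[ℤ[X]] J) : WithBot ℕ → Submodule ℤ[X] J
  | none => ⊥
  | some i => (levelSubmodule p A i).map π

/-- The abstract form of the condition defining `i(K/F)`. -/
def IsNormAdmissible (p n : ℕ) {A J : Type*} [AddCommGroup A] [Module ℤ[X] A]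
    [AddCommGroup J] [Module ℤ[X] J] (π : A →ₗ[ℤ[X]] J) (i : WithBot ℕ) (d : A) : Prop :=
  d ∉ trivialNormSubmodule p n A ∧ (X - 1 : ℤ[X]) • π d ∈ levelImage p π i

namespace IsModP

variable {p : ℕ} {A J : Type*} [AddCommGroup A] [Module ℤ[X] A] [AddCommGroup J] [Module ℤ[X] J]
  {π : A →ₗ[ℤ[X]] J} (hπ : IsModP p π)

include hπ

theorem nsmul_eq_zero (y : J) : p • y = 0 := by
  obtain ⟨a, rfl⟩ := hπ.surjective y
  rw [← map_nsmul, hπ.eq_zero_iff]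
  exact ⟨a, rfl⟩

theorem map_nsmul_self (a : A) : π (p • a) = 0 := (hπ.eq_zero_iff _).2 ⟨a, rfl⟩

theorem map_eq_iff {a b : A} : π a = π b ↔ ∃ c, a = b + p • c := by
  rw [← sub_eq_zero, ← map_sub, hπ.eq_zero_iff]
  exact exists_congr fun c => ⟨fun h => by rw [h]; abel, fun h => by rw [h]; abel⟩

theorem mem_trivialNorm_of_map_eq {n : ℕ}
    (htop : ∀ a, a ∈ levelSubmodule p A n) {a b : A} (hab : π a = π b)
    (hb : b ∈ trivialNormSubmodule p n A) : a ∈ trivialNormSubmodule p n A := by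
  obtain ⟨c, rfl⟩ := hπ.map_eq_iff.1 hab
  refine Submodule.add_mem _ hb (mem_trivialNormSubmodule.2 ⟨normPoly p n 0 • c, ?_, ?_⟩)
  · exact normPoly_smul_mem (Nat.zero_le n) (htop c)
  · rw [smul_nsmul_comm]

theorem exists_of_fixed {i : ℕ} {a : A} (ha : (X ^ p ^ i - 1 : ℤ[X]) • π a = 0) :
    ∃ b, (X ^ p ^ i - 1 : ℤ[X]) • a = p • b := by
  rw [← map_smul, hπ.eq_zero_iff] at ha
  exact ha.imp fun _ => Eq.symm

end IsModP

namespace IsKummerTower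

variable {p n : ℕ} [hp : Fact p.Prime] {A J : Type*} [AddCommGroup A] [Module ℤ[X] A] {ξ : A}
  [AddCommGroup J] [Module ℤ[X] J] {π : A →ₗ[ℤ[X]] J}
  (h : IsKummerTower p n ξ) (hπ : IsModP p π)

include h

omit hp in
theorem X_sub_one_smul_mem_trivialNorm (a : A) :
    (X - 1 : ℤ[X]) • a ∈ trivialNormSubmodule p n A := by
  refine mem_trivialNormSubmodule.2 ⟨0, zero_mem _, ?_⟩
  rw [smul_smul, normPoly.mul_X_sub_one, smul_zero, mem_levelSubmodule.1 (h.mem_top a)]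

omit hp in
theorem X_sub_one_pow_smul_mem_trivialNorm {r : ℕ} (hr : r ≠ 0) (a : A) :
    (X - 1 : ℤ[X]) ^ r • a ∈ trivialNormSubmodule p n A := by
  obtain ⟨r, rfl⟩ := Nat.exists_eq_succ_of_ne_zero hr
  rw [pow_succ', mul_smul]
  exact h.X_sub_one_smul_mem_trivialNorm _

omit h in
-- On level i the full norm is p^(n-i) times the norm to level 0, and n - i ≥ 1.
theorem level_le_trivialNorm {i : ℕ} (hi : i < n) :
    levelSubmodule p A i ≤ trivialNormSubmodule p n A := by
  intro a ha
  refine mem_trivialNormSubmodule.2 ⟨p ^ (n - i - 1) • normPoly p i 0 • a, ?_, ?_⟩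
  · exact nsmul_mem (normPoly_smul_mem (Nat.zero_le i) ha) _
  · rw [← normPoly.mul_normPoly hp.out hi.le (Nat.zero_le i), mul_smul,
      normPoly_smul_eq_nsmul ha, smul_nsmul_comm, smul_smul, ← pow_succ']
    congr 2; omega

omit hp in
theorem exists_normPoly_smul_eq_nsmul_root {i : ℕ} (hi : i ≤ n) {a b : A}
    (hab : (X ^ p ^ i - 1 : ℤ[X]) • a = p • b) : ∃ c : ℕ, normPoly p n i • b = c • ξ := by
  apply h.torsion
  rw [← smul_nsmul_comm, ← hab, smul_smul, normPoly.mul_X_pow_sub_one hi,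
    mem_levelSubmodule.1 (h.mem_top a)]

omit hp in
include hπ in
-- By Hilbert 90, b = (X^(p^i) - 1)c, so a - p c is at level i and has the class of a.
theorem map_mem_of_normPoly_smul_eq_zero {i : ℕ} (hi : i ≤ n) {a b : A}
    (hab : (X ^ p ^ i - 1 : ℤ[X]) • a = p • b) (hb : normPoly p n i • b = 0) :
    π a ∈ (levelSubmodule p A i).map π := by
  obtain ⟨c, -, rfl⟩ := h.hilbert90 n i hi le_rfl b (h.mem_top b) hb
  refine ⟨a - p • c, ?_, ?_⟩
  · rw [SetLike.mem_coe, mem_levelSubmodule, smul_sub, hab, smul_nsmul_comm, sub_self]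
  · rw [map_sub, hπ.map_nsmul_self, sub_zero]

/-- Expanding the norm polynomial modulo X^(p^i) - 1 gives a p-th root w of the norm of a to level
i, and (X^(p^i) - 1)w is the norm of b. Were the full norm of a equal to p f, the norm of w to level
0 would be f plus p-torsion, hence fixed by X, making (X^(p^i) - 1)w zero. -/
theorem notMem_trivialNorm {i : ℕ} (hi : i < n) {a b : A}
    (hab : (X ^ p ^ i - 1 : ℤ[X]) • a = p • b) (hb : normPoly p n i • b ≠ 0) :
    a ∉ trivialNormSubmodule p n A := by
  intro ha
  obtain ⟨f, hf, hfa⟩ := mem_trivialNormSubmodule.1 ha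
  obtain ⟨c, hc⟩ := h.exists_normPoly_smul_eq_nsmul_root hi.le hab
  set w := p ^ (n - i - 1) • a + normPoly.remainder p n i • b with hw
  have h1 : normPoly p n i • a = p • w := by
    rw [normPoly.eq_add_remainder, add_smul, mul_smul, hab, smul_nsmul_comm, hw, smul_add,
      smul_smul, ← pow_succ', show n - i - 1 + 1 = n - i by omega, ← Nat.cast_pow,
      Nat.cast_smul_eq_nsmul]
  have h2 : (X ^ p ^ i - 1 : ℤ[X]) • w = normPoly p n i • b := by
    rw [normPoly.eq_add_remainder, add_smul, hw, smul_add, smul_nsmul_comm, hab, smul_smul,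
      ← pow_succ, show n - i - 1 + 1 = n - i by omega, ← Nat.cast_pow, Nat.cast_smul_eq_nsmul,
      smul_smul, mul_comm]
  have h3 : p • (normPoly p i 0 • w - f) = 0 := by
    rw [smul_sub, hfa, ← smul_nsmul_comm, ← h1, smul_smul,
      normPoly.mul_normPoly hp.out hi.le (Nat.zero_le i), sub_self]
  obtain ⟨c', hc'⟩ := h.torsion _ h3
  apply hb
  rw [← h2, ← normPoly.mul_X_sub_one, mul_comm, mul_smul, ← sub_add_cancel (normPoly p i 0 • w) f,
    hc', smul_add, mem_levelSubmodule_zero.1 hf, smul_nsmul_comm, h.X_smul_root, smul_zero,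
    add_zero]

include hπ in
theorem map_mem_of_fixed_of_trivialNorm {i : ℕ} (hi : i < n) {a : A}
    (ha : (X ^ p ^ i - 1 : ℤ[X]) • π a = 0) (haZ : a ∈ trivialNormSubmodule p n A) :
    π a ∈ (levelSubmodule p A i).map π := by
  obtain ⟨b, hb⟩ := hπ.exists_of_fixed ha
  by_contra hn
  exact h.notMem_trivialNorm hi hb
    (fun h0 => hn (h.map_mem_of_normPoly_smul_eq_zero hπ hi.le hb h0)) haZ

include hπ in
theorem mem_trivialNorm_of_map_mem {i : ℕ} (hi : i < n) {a : A}
    (ha : π a ∈ (levelSubmodule p A i).map π) : a ∈ trivialNormSubmodule p n A := by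
  obtain ⟨b, hb, hba⟩ := ha
  exact hπ.mem_trivialNorm_of_map_eq h.mem_top hba.symm (level_le_trivialNorm hi hb)

include hπ in
theorem exists_normPoly_smul_eq_root_of_fixed {i : ℕ} (hi : i < n) {a : A}
    (ha : (X ^ p ^ i - 1 : ℤ[X]) • π a = 0) (haZ : a ∉ trivialNormSubmodule p n A) :
    ∃ b, normPoly p n i • b = ξ := by
  obtain ⟨b, hb⟩ := hπ.exists_of_fixed ha
  obtain ⟨c, hc⟩ := h.exists_normPoly_smul_eq_nsmul_root hi.le hb
  have h0 : c • ξ ≠ 0 := fun h0 => haZ (h.mem_trivialNorm_of_map_mem hπ hi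
    (h.map_mem_of_normPoly_smul_eq_zero hπ hi.le hb (hc.trans h0)))
  obtain ⟨e, he⟩ := h.exists_nsmul_nsmul_root h0
  exact ⟨e • b, by rw [smul_nsmul_comm, hc, he]⟩

include hπ in
-- The obstruction to descending a fixed class to level i lies in the group of order p generated by
-- ξ. That of d is nonzero, so a multiple of d cancels that of a.
theorem exists_sub_nsmul_map_mem_of_fixed {i : ℕ} (hi : i < n) {a d : A}
    (ha : (X ^ p ^ i - 1 : ℤ[X]) • π a = 0) (hd : (X ^ p ^ i - 1 : ℤ[X]) • π d = 0)
    (hdZ : d ∉ trivialNormSubmodule p n A) :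
    ∃ c : ℕ, π (a - c • d) ∈ (levelSubmodule p A i).map π := by
  obtain ⟨b, hb⟩ := hπ.exists_of_fixed ha
  obtain ⟨c, hc⟩ := h.exists_normPoly_smul_eq_nsmul_root hi.le hb
  obtain ⟨b', hb'⟩ := hπ.exists_of_fixed hd
  obtain ⟨c', hc'⟩ := h.exists_normPoly_smul_eq_nsmul_root hi.le hb'
  have h0 : c' • ξ ≠ 0 := fun h0 => hdZ (h.mem_trivialNorm_of_map_mem hπ hi
    (h.map_mem_of_normPoly_smul_eq_zero hπ hi.le hb' (hc'.trans h0)))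
  obtain ⟨e, he⟩ := h.exists_nsmul_nsmul_root h0
  refine ⟨c * e, h.map_mem_of_normPoly_smul_eq_zero hπ hi.le (b := b - (c * e) • b') ?_ ?_⟩
  · rw [smul_sub, smul_sub, smul_nsmul_comm, hb, hb', smul_comm p (c * e)]
  · rw [smul_sub, smul_nsmul_comm, hc, hc', mul_smul, he, sub_self]

include hπ in
-- If ξ is the norm of b, then p b has trivial norm, so p b = (X - 1)d; the obstruction of d at
-- level 0 is ξ itself.
theorem exists_admissible_bot (hx : ∃ b, normPoly p n 0 • b = ξ) :
    ∃ d, IsNormAdmissible p n π ⊥ d := by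
  obtain ⟨b, hb⟩ := hx
  obtain ⟨d, -, hd⟩ := h.hilbert90 n 0 (Nat.zero_le n) le_rfl (p • b) (h.mem_top _)
    (by rw [smul_nsmul_comm, hb, h.nsmul_root])
  refine ⟨d, h.notMem_trivialNorm h.pos hd (hb ▸ h.root_ne_zero), ?_⟩
  rw [pow_zero, pow_one] at hd
  change _ ∈ (⊥ : Submodule ℤ[X] J)
  rw [← map_smul, hd, hπ.map_nsmul_self]
  exact zero_mem _

include hπ in
-- Write ξ = p^(n-i-1) g + N(μ), with N the full norm. Multiplying by p shows that g is the norm of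
-- some k at level i. Then k + p μ has norm p ξ = 0, so it is (X - 1)d, and the obstruction of d at
-- level i + 1 is again ξ.
theorem exists_admissible_of_succ {i : ℕ} (hi : i + 1 < n) (hx : ∃ b, normPoly p n (i + 1) • b = ξ) :
    ∃ d, IsNormAdmissible p n π (i : ℕ) d := by
  obtain ⟨b, hb⟩ := hx
  obtain ⟨g, hg, μ, -, hgμ⟩ := h.exists_of_normPoly_smul_mem hi.le le_rfl (h.mem_top b)
    (hb ▸ h.root_mem 0)
  rw [hb] at hgμ
  obtain ⟨k, hk, hkg⟩ := h.exists_normPoly_smul_eq_of_nsmul (j := i) (by omega) hg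
      (b := -(p • μ)) (by
    have := congrArg (p • ·) hgμ
    simp only [smul_add, h.nsmul_root, smul_smul, ← pow_succ'] at this
    rw [show n - i = n - (i + 1) + 1 by omega, smul_neg, smul_nsmul_comm]
    exact eq_neg_of_add_eq_zero_left this.symm)
  have hg' := levelSubmodule_mono (p := p) (Nat.zero_le i) hg
  obtain ⟨d, -, hd⟩ := h.hilbert90 n 0 (Nat.zero_le n) le_rfl (k + p • μ) (h.mem_top _) (by
    rw [smul_add, ← normPoly.mul_normPoly hp.out (show i ≤ n by omega) (Nat.zero_le i), mul_smul,
      normPoly_smul_eq_nsmul hk, smul_nsmul_comm, hkg,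
      normPoly.mul_normPoly hp.out (show i ≤ n by omega) (Nat.zero_le i), smul_nsmul_comm,
      show n - i = n - (i + 1) + 1 by omega, pow_succ', mul_smul, ← smul_add, ← hgμ, h.nsmul_root])
  rw [pow_zero, pow_one] at hd
  refine ⟨d, ?_, ?_⟩
  · refine h.notMem_trivialNorm hi (b := g + normPoly p (i + 1) 0 • μ) ?_ ?_
    · rw [← normPoly.mul_X_sub_one, mul_smul, hd, smul_add, smul_nsmul_comm,
        ← normPoly.mul_normPoly hp.out (Nat.le_succ i) (Nat.zero_le i), mul_smul,
        normPoly_smul_eq_nsmul hk, smul_nsmul_comm, hkg,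
        show i.succ - i = 1 by omega, pow_one, ← smul_add]
    · rw [smul_add, normPoly_smul_eq_nsmul (levelSubmodule_mono (Nat.zero_le _) hg), smul_smul,
        mul_comm, normPoly.mul_normPoly hp.out hi.le (Nat.zero_le _), ← hgμ]
      exact h.root_ne_zero
  · refine ⟨k, hk, ?_⟩
    rw [← map_smul, hd, map_add, hπ.map_nsmul_self, add_zero]

end IsKummerTower

/-! ### The minimal index and the filtration of the socle by norms. -/

/-- The norms to level `0` of the elements of level `i`, modulo `p`. -/
noncomputable def normImage (p : ℕ) {A J : Type*} [AddCommGroup A] [Module ℤ[X] A]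
    [AddCommGroup J] [Module ℤ[X] J] (π : A →ₗ[ℤ[X]] J) (i : ℕ) : Submodule ℤ[X] J :=
  ((levelSubmodule p A i).map (LinearMap.lsmul ℤ[X] A (normPoly p i 0))).map π

theorem mem_normImage {p : ℕ} {A J : Type*} [AddCommGroup A] [Module ℤ[X] A]
    [AddCommGroup J] [Module ℤ[X] J] {π : A →ₗ[ℤ[X]] J} {i : ℕ} {v : J} :
    v ∈ normImage p π i ↔ ∃ t ∈ levelSubmodule p A i, π (normPoly p i 0 • t) = v := by
  simp [normImage]

namespace IsKummerTower

variable {p n : ℕ} [hp : Fact p.Prime] {A J : Type*} [AddCommGroup A] [Module ℤ[X] A] {ξ : A}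
  [AddCommGroup J] [Module ℤ[X] J] {π : A →ₗ[ℤ[X]] J}
  (h : IsKummerTower p n ξ) (hπ : IsModP p π)

include h

omit hp in
theorem remainder_smul_root (i j : ℕ) :
    normPoly.remainder p i j • ξ = (∑ s ∈ Finset.range (p ^ (i - j)), s) • ξ := by
  have hX : ∀ r : ℕ, ((X : ℤ[X]) ^ p ^ j) ^ r • ξ = ξ := by
    have h1 : (X : ℤ[X]) ^ p ^ j • ξ = ξ := by
      have := mem_levelSubmodule.1 (h.root_mem j)
      rwa [sub_smul, one_smul, sub_eq_zero] at this
    intro r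
    induction r with
    | zero => simp
    | succ r ih => rw [pow_succ, mul_smul, h1, ih]
  rw [normPoly.remainder, Finset.sum_smul, Finset.sum_smul]
  refine Finset.sum_congr rfl fun s _ => ?_
  rw [Finset.sum_smul, Finset.sum_congr rfl fun r _ => hX r, Finset.sum_const, Finset.card_range]

theorem remainder_smul_root_eq_zero (hp2 : p ≠ 2) {i j : ℕ} (hij : j < i) :
    normPoly.remainder p i j • ξ = 0 := by
  obtain ⟨k, hk⟩ := (hp.out.odd_of_ne_two hp2).pow (n := i - j)
  obtain ⟨r, hr⟩ := Nat.exists_eq_add_of_lt hij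
  have : ∑ s ∈ Finset.range (p ^ (i - j)), s = p ^ (i - j) * k := by
    rw [Finset.sum_range_id, hk, Nat.add_sub_cancel, Nat.mul_comm 2 k, ← Nat.mul_assoc,
      Nat.mul_div_cancel _ two_pos]
  rw [h.remainder_smul_root, this, show i - j = r + 1 by omega, mul_comm, pow_succ, mul_smul,
    mul_smul, h.nsmul_root, smul_zero, smul_zero]

include hπ in
-- If ξ is not a norm from the top, let k at level n - 1 have norm ξ and solve (X - 1)d = k. The
-- norm of d is p times `normPoly p (n-1) 0 • d` plus a correction p(p-1)/2 · p^(n-1) ξ, which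
-- vanishes for odd p, and for p = 2 as soon as n > 1.
theorem exists_lt_admissible :
    ∃ i : WithBot ℕ, i < n ∧ ∃ d, IsNormAdmissible p n π i d := by
  by_cases hx : ∃ b, normPoly p n 0 • b = ξ
  · exact ⟨⊥, WithBot.bot_lt_coe n, h.exists_admissible_bot hπ hx⟩
  obtain ⟨q, rfl⟩ := Nat.exists_eq_succ_of_ne_zero (Nat.one_le_iff_ne_zero.1 h.pos)
  obtain ⟨k, hk, hkξ⟩ := h.exists_normPoly_smul_eq_root (Nat.lt_succ_self q)
  obtain ⟨d, -, hd⟩ := h.hilbert90 (q + 1) 0 (Nat.zero_le _) le_rfl k (h.mem_top _) (by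
    rw [← normPoly.mul_normPoly hp.out (Nat.le_succ q) (Nat.zero_le q), mul_smul,
      normPoly_smul_eq_nsmul hk, smul_nsmul_comm, hkξ, Nat.succ_sub (le_refl q), Nat.sub_self,
      pow_one, h.nsmul_root])
  rw [pow_zero, pow_one] at hd
  have hd1 : (X ^ p ^ q - 1 : ℤ[X]) • d = ξ := by
    rw [← normPoly.mul_X_sub_one, mul_smul, hd, hkξ]
  have hrem : normPoly p q 0 • normPoly.remainder p (q + 1) q • ξ = 0 := by
    by_cases hp2 : p = 2
    · have h1 := (h.even hp2).resolve_right hx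
      obtain ⟨r, rfl⟩ := Nat.exists_eq_succ_of_ne_zero (show q ≠ 0 by omega)
      rw [smul_comm, normPoly_smul_eq_nsmul (h.root_mem 0), Nat.sub_zero, pow_succ, mul_smul,
        h.nsmul_root, smul_zero, smul_zero]
    · rw [h.remainder_smul_root_eq_zero hp2 (Nat.lt_succ_self q), smul_zero]
  refine ⟨q, WithBot.coe_lt_coe.2 (Nat.lt_succ_self q), d, fun hdZ => ?_, ⟨k, hk, ?_⟩⟩
  · obtain ⟨f, hf, hfd⟩ := mem_trivialNormSubmodule.1 hdZ
    have h1 : p • (normPoly p q 0 • d - f) = 0 := by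
      rw [smul_sub, hfd, ← normPoly.mul_normPoly hp.out (Nat.le_succ q) (Nat.zero_le q), mul_smul,
        normPoly.eq_add_remainder p q.succ, add_smul, mul_smul, hd1, smul_add, hrem, add_zero,
        show q.succ - q = 1 by omega, pow_one, Nat.cast_smul_eq_nsmul, smul_nsmul_comm, sub_self]
    obtain ⟨c, hc⟩ := h.torsion _ h1
    apply h.root_ne_zero
    rw [← hkξ, ← hd, smul_comm, ← sub_add_cancel (normPoly p q 0 • d) f, hc, smul_add,
      mem_levelSubmodule_zero.1 hf, smul_nsmul_comm, h.X_smul_root, smul_zero, add_zero]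
  · rw [← map_smul, hd]

include hπ in
theorem mem_trivialNorm_of_nsmul {c : ℕ} (hc : ¬ p ∣ c) {d : A}
    (hd : c • d ∈ trivialNormSubmodule p n A) : d ∈ trivialNormSubmodule p n A := by
  obtain ⟨e, -, he⟩ := Nat.exists_mul_mod_eq_one_of_coprime
    ((Nat.coprime_comm.1 ((hp.out.coprime_iff_not_dvd).2 hc))) hp.out.one_lt
  have h1 : e • c • d ∈ trivialNormSubmodule p n A := nsmul_mem hd e
  refine hπ.mem_trivialNorm_of_map_eq h.mem_top ?_ h1
  rw [smul_smul, mul_comm, ← Nat.mod_add_div (c * e) p, he, add_smul, one_smul, mul_smul, map_add,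
    hπ.map_nsmul_self, add_zero]

omit h in
theorem normImage_anti {i j : ℕ} (hij : j ≤ i) : normImage p π i ≤ normImage p π j := by
  intro v hv
  obtain ⟨t, ht, rfl⟩ := mem_normImage.1 hv
  exact mem_normImage.2 ⟨normPoly p i j • t, normPoly_smul_mem hij ht, by
    rw [smul_smul, normPoly.mul_normPoly hp.out hij (Nat.zero_le j)]⟩

section Minimal

variable {m : WithBot ℕ} (hm : IsLeast {i : WithBot ℕ | i ≤ n ∧ ∃ d, IsNormAdmissible p n π i d} m)
  {d : A} (hd : IsNormAdmissible p n π m d)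

include hπ hm

theorem lt_of_isLeast : m < n := by
  obtain ⟨i, hi, hd⟩ := h.exists_lt_admissible hπ
  exact (hm.2 ⟨hi.le, hd⟩).trans_lt hi

/-- Otherwise the two constructions of admissible elements would give an index below i, hence below
m. -/
theorem normPoly_smul_ne_root {i : ℕ} (hi : (i : WithBot ℕ) ≤ m) (b : A) :
    normPoly p n i • b ≠ ξ := by
  intro hb
  have hin : i < n := WithBot.coe_lt_coe.1 (hi.trans_lt (h.lt_of_isLeast hπ hm))
  cases i with
  | zero =>
    have := hm.2 ⟨bot_le, h.exists_admissible_bot hπ ⟨b, hb⟩⟩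
    exact absurd (hi.trans this) (by simp)
  | succ i =>
    have := hm.2 ⟨WithBot.coe_le_coe.2 (show i ≤ n by omega), h.exists_admissible_of_succ hπ hin ⟨b, hb⟩⟩
    have : i + 1 ≤ i := WithBot.coe_le_coe.1 (hi.trans this)
    omega

theorem map_mem_of_fixed_of_le {i : ℕ} (hi : (i : WithBot ℕ) ≤ m) {a : A}
    (ha : (X ^ p ^ i - 1 : ℤ[X]) • π a = 0) : π a ∈ (levelSubmodule p A i).map π := by
  have hin : i < n := WithBot.coe_lt_coe.1 (hi.trans_lt (h.lt_of_isLeast hπ hm))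
  by_cases haZ : a ∈ trivialNormSubmodule p n A
  · exact h.map_mem_of_fixed_of_trivialNorm hπ hin ha haZ
  · obtain ⟨b, hb⟩ := h.exists_normPoly_smul_eq_root_of_fixed hπ hin ha haZ
    exact absurd hb (h.normPoly_smul_ne_root hπ hm hi b)

include hd

theorem socle_ne_zero : (X - 1 : ℤ[X]) ^ PowerClasses.powBot p m • π d ≠ 0 := by
  intro h0
  apply hd.1
  cases m with
  | bot =>
    change (X - 1 : ℤ[X]) ^ 0 • π d = 0 at h0
    rw [pow_zero, one_smul] at h0
    exact hπ.mem_trivialNorm_of_map_eq h.mem_top (h0.trans (map_zero π).symm) (zero_mem _)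
  | coe i =>
    change (X - 1 : ℤ[X]) ^ (p ^ i) • π d = 0 at h0
    rw [← X_pow_sub_one_smul hπ.nsmul_eq_zero] at h0
    exact h.mem_trivialNorm_of_map_mem hπ (WithBot.coe_lt_coe.1 (h.lt_of_isLeast hπ hm))
      (h.map_mem_of_fixed_of_le hπ hm le_rfl h0)

omit h hm in
theorem pow_succ_smul_eq_zero : (X - 1 : ℤ[X]) ^ (PowerClasses.powBot p m + 1) • π d = 0 := by
  rw [pow_succ, mul_smul]
  cases m with
  | bot =>
    rw [(show (X - 1 : ℤ[X]) • π d = 0 from hd.2), smul_zero]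
  | coe i =>
    obtain ⟨t, ht, htd⟩ := hd.2
    change (X - 1 : ℤ[X]) ^ (p ^ i) • _ = 0
    rw [← htd, ← X_pow_sub_one_smul hπ.nsmul_eq_zero, ← map_smul, mem_levelSubmodule.1 ht, map_zero]

omit h hm in
theorem pow_smul_eq_zero {l : ℕ} (hl : PowerClasses.powBot p m < l) :
    (X - 1 : ℤ[X]) ^ l • π d = 0 := by
  obtain ⟨r, rfl⟩ := Nat.exists_eq_add_of_lt hl
  rw [show PowerClasses.powBot p m + r + 1 = r + (PowerClasses.powBot p m + 1) by omega, pow_add,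
    mul_smul, pow_succ_smul_eq_zero hπ hd, smul_zero]

/-- For m = k, if e were the class of the norm of t, then d - (X - 1)^(p^i - 1 - p^k) t would have a
class killed by (X - 1)^(p^k), hence a class from level k with trivial norm class. As the term in t
also has trivial norm class, so would d. -/
theorem socle_notMem_normImage {i : ℕ} (hmi : m < i) (hi : i ≤ n) :
    (X - 1 : ℤ[X]) ^ PowerClasses.powBot p m • π d ∉ normImage p π i := by
  intro he
  obtain ⟨t, ht, hte⟩ := mem_normImage.1 he
  apply hd.1
  cases m with
  | bot =>
    change _ = (X - 1 : ℤ[X]) ^ 0 • π d at hte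
    rw [pow_zero, one_smul] at hte
    exact h.mem_trivialNorm_of_map_mem hπ h.pos ⟨_, normPoly_smul_mem (Nat.zero_le i) ht, hte⟩
  | coe k =>
    have hki : k < i := WithBot.coe_lt_coe.1 hmi
    have hkn : k < n := by omega
    change _ = (X - 1 : ℤ[X]) ^ (p ^ k) • π d at hte
    have hlt : p ^ k < p ^ i := Nat.pow_lt_pow_right hp.out.one_lt hki
    have h1 : (X ^ p ^ k - 1 : ℤ[X]) • π (d - (X - 1 : ℤ[X]) ^ (p ^ i - 1 - p ^ k) • t) = 0 := by
      rw [X_pow_sub_one_smul hπ.nsmul_eq_zero, map_sub, smul_sub, map_smul, smul_smul, ← pow_add,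
        show p ^ k + (p ^ i - 1 - p ^ k) = p ^ i - 1 by omega,
        ← normPoly_zero_smul hπ.nsmul_eq_zero, ← map_smul π (normPoly p i 0), hte, sub_self]
    have h2 := h.mem_trivialNorm_of_map_mem hπ hkn (h.map_mem_of_fixed_of_le hπ hm le_rfl h1)
    suffices (X - 1 : ℤ[X]) ^ (p ^ i - 1 - p ^ k) • t ∈ trivialNormSubmodule p n A by
      simpa using add_mem h2 this
    rcases hi.lt_or_eq with hi | rfl
    · exact Submodule.smul_mem _ _ (level_le_trivialNorm hi ht)
    -- Exponent zero means p = 2, k = 0 and top level 1. Then ξ = -1 is assumed to be a norm,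
    -- contrary to the minimal index being 0.
    by_cases hr : p ^ i - 1 - p ^ k = 0
    · exfalso
      have hpi : p ^ i = p ^ k + 1 := by omega
      have hk0 : k = 0 := by
        by_contra hk0
        have h3 : p ∣ p ^ k := dvd_pow_self p hk0
        have h4 : p ∣ p ^ k + 1 := hpi ▸ dvd_pow_self p (by omega : i ≠ 0)
        exact hp.out.one_lt.ne' (Nat.dvd_one.1 ((Nat.dvd_add_right h3).1 h4))
      subst hk0
      rw [pow_zero] at hpi
      have hp2 : p = 2 := (Nat.prime_dvd_prime_iff_eq hp.out Nat.prime_two).1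
        (by
          have := dvd_pow_self p (by omega : i ≠ 0)
          rwa [hpi] at this)
      rcases h.even hp2 with h5 | ⟨x, hx⟩
      · have := Nat.pow_lt_pow_right hp.out.one_lt h5
        rw [pow_one] at this
        omega
      · exact h.normPoly_smul_ne_root hπ hm le_rfl x hx
    · exact h.X_sub_one_pow_smul_mem_trivialNorm hr t

omit hd hm

omit hπ in
theorem map_root_mem_normImage {i : ℕ} (hi : i < n) : π ξ ∈ normImage p π i := by
  obtain ⟨c, hc, hcξ⟩ := h.exists_normPoly_smul_eq_root hi
  exact mem_normImage.2 ⟨c, hc, by rw [hcξ]⟩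

/-- Taking norms from level i + 1 to level i kills the left side and leaves p(f + norm of b) = 0. So
f is, up to a multiple of ξ, minus a norm lying at level 0, and such a norm is a full norm to level
0 modulo p. -/
theorem exists_map_eq_add_nsmul_root {i : ℕ} (hi : i + 1 ≤ n) {t f b : A}
    (ht : t ∈ levelSubmodule p A (i + 1)) (hf : f ∈ levelSubmodule p A 0)
    (htf : (X ^ p ^ i - 1 : ℤ[X]) • t = f + p • b) :
    ∃ c : ℕ, ∃ v ∈ normImage p π (i + 1), π f = v + c • π ξ := by
  have h1 : p • (normPoly p (i + 1) i • b + f) = 0 := by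
    have h2 := congrArg (normPoly p (i + 1) i • ·) htf
    simp only [smul_add] at h2
    rw [smul_smul, normPoly.mul_X_pow_sub_one (Nat.le_succ i), mem_levelSubmodule.1 ht,
      normPoly_smul_eq_nsmul (levelSubmodule_mono (Nat.zero_le i) hf), Nat.add_sub_cancel_left,
      pow_one, smul_nsmul_comm] at h2
    rw [smul_add, add_comm, ← h2]
  obtain ⟨c, hc⟩ := h.torsion _ h1
  have hb : b ∈ levelSubmodule p A (i + 1) := by
    rw [mem_levelSubmodule, ← normPoly.mul_X_pow_sub_one (Nat.le_succ i), mul_comm, mul_smul,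
      eq_sub_of_add_eq hc]
    exact mem_levelSubmodule.1 (levelSubmodule_mono (Nat.zero_le i)
      (sub_mem (nsmul_mem (h.root_mem 0) c) hf))
  obtain ⟨g, -, u, hu, hgu⟩ := h.exists_of_normPoly_smul_mem (Nat.le_succ i) hi hb (by
    rw [eq_sub_of_add_eq hc]
    exact sub_mem (nsmul_mem (h.root_mem 0) c) hf)
  refine ⟨c, -π (normPoly p (i + 1) 0 • u), neg_mem (mem_normImage.2 ⟨u, hu, rfl⟩), ?_⟩
  rw [show f = c • ξ - (p • g + normPoly p (i + 1) 0 • u) by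
    rw [← hc, hgu, Nat.succ_sub (le_refl i), Nat.sub_self, pow_one]; abel]
  rw [map_sub, map_add, hπ.map_nsmul_self, map_nsmul]
  abel

theorem exists_pow_smul_map_eq_add_nsmul_root {i l : ℕ} (hi : i + 1 ≤ n) (hl : p ^ i ≤ l) {t : A}
    (ht : t ∈ levelSubmodule p A (i + 1)) (h0 : (X - 1 : ℤ[X]) ^ (l + 1) • π t = 0) :
    ∃ c : ℕ, ∃ v ∈ normImage p π (i + 1), (X - 1 : ℤ[X]) ^ l • π t = v + c • π ξ := by
  have hl0 : l ≠ 0 := (hl.trans_lt' (pow_pos hp.out.pos i)).ne'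
  have h1 : π ((X - 1 : ℤ[X]) ^ l • t) ∈ (levelSubmodule p A 0).map π := by
    refine h.map_mem_of_fixed_of_trivialNorm hπ h.pos ?_ (h.X_sub_one_pow_smul_mem_trivialNorm hl0 t)
    rw [map_smul, pow_zero, pow_one, smul_smul, ← pow_succ', h0]
  obtain ⟨f, hf, hft⟩ := h1
  have h2 : π ((X ^ p ^ i - 1 : ℤ[X]) • (X - 1 : ℤ[X]) ^ (l - p ^ i) • t) = π f := by
    rw [hft, map_smul, map_smul, X_pow_sub_one_smul hπ.nsmul_eq_zero, smul_smul, ← pow_add,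
      Nat.add_sub_cancel' hl, map_smul]
  obtain ⟨b, hb⟩ := hπ.map_eq_iff.1 h2
  obtain ⟨c, v, hv, hvf⟩ := h.exists_map_eq_add_nsmul_root hπ hi (Submodule.smul_mem _ _ ht) hf hb
  exact ⟨c, v, hv, by rw [← map_smul, ← hft, hvf]⟩

include hm hd

theorem exists_eq_add_nsmul_socle_of_fixed {y : J} (hy : (X - 1 : ℤ[X]) • y = 0) :
    ∃ c : ℕ, ∃ v ∈ normImage p π 0,
      y = v + c • (X - 1 : ℤ[X]) ^ PowerClasses.powBot p m • π d := by
  have key : ∀ y ∈ (levelSubmodule p A 0).map π, y ∈ normImage p π 0 := by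
    rintro _ ⟨t, ht, rfl⟩
    exact mem_normImage.2 ⟨t, ht, by rw [normPoly.self, one_smul]⟩
  obtain ⟨a, rfl⟩ := hπ.surjective y
  have hy' : (X ^ p ^ 0 - 1 : ℤ[X]) • π a = 0 := by rwa [pow_zero, pow_one]
  cases m with
  | bot =>
    have hd' : (X ^ p ^ 0 - 1 : ℤ[X]) • π d = 0 := by rw [pow_zero, pow_one]; exact hd.2
    obtain ⟨c, hc⟩ := h.exists_sub_nsmul_map_mem_of_fixed hπ h.pos hy' hd' hd.1
    refine ⟨c, _, key _ hc, ?_⟩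
    change _ = _ + c • (X - 1 : ℤ[X]) ^ 0 • π d
    rw [pow_zero, one_smul, map_sub, map_nsmul, sub_add_cancel]
  | coe k =>
    exact ⟨0, _, key _ (h.map_mem_of_fixed_of_le hπ hm (WithBot.coe_le_coe.2 (Nat.zero_le k)) hy'),
      by rw [zero_smul, add_zero]⟩

/-- Modulo [d], y comes from level i + 1, where the result holds up to multiples of [ξ]. Below the
top, [ξ] lies in the norm image. At the top, either m < n - 1 and ξ is a norm to level n - 1, or m =
n - 1 and [ξ] can be traded for e. -/
theorem exists_pow_smul_eq_add_nsmul_socle {i l : ℕ} (hi : i + 1 ≤ n) (hl : p ^ i ≤ l)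
    (hl' : l < p ^ (i + 1)) {y : J} (hy : (X - 1 : ℤ[X]) ^ (l + 1) • y = 0) :
    ∃ c : ℕ, ∃ v ∈ normImage p π (i + 1),
      (X - 1 : ℤ[X]) ^ l • y = v + c • (X - 1 : ℤ[X]) ^ PowerClasses.powBot p m • π d ∧
      (PowerClasses.powBot p m < l → c = 0) := by
  obtain ⟨a, rfl⟩ := hπ.surjective y
  have hmn := h.lt_of_isLeast hπ hm
  rcases hi.lt_or_eq with hi' | hin
  · have hfix : (X ^ p ^ (i + 1) - 1 : ℤ[X]) • π a = 0 := by
      rw [X_pow_sub_one_smul hπ.nsmul_eq_zero,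
        show p ^ (i + 1) = (p ^ (i + 1) - (l + 1)) + (l + 1) by omega, pow_add, mul_smul, hy,
        smul_zero]
    obtain ⟨c, hca, hc⟩ : ∃ c : ℕ, π (a - c • d) ∈ (levelSubmodule p A (i + 1)).map π ∧
        (c = 0 ∨ PowerClasses.powBot p m ≤ l) := by
      rcases le_or_gt ((i + 1 : ℕ) : WithBot ℕ) m with hmi | hmi
      · refine ⟨0, ?_, Or.inl rfl⟩
        rw [zero_smul, sub_zero]
        exact h.map_mem_of_fixed_of_le hπ hm hmi hfix
      · have hL : PowerClasses.powBot p m ≤ l := by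
          cases m with
          | bot => exact Nat.zero_le _
          | coe k =>
            have : k < i + 1 := WithBot.coe_lt_coe.1 hmi
            exact (Nat.pow_le_pow_right hp.out.pos (show k ≤ i by omega)).trans hl
        have hfixd : (X ^ p ^ (i + 1) - 1 : ℤ[X]) • π d = 0 := by
          rw [X_pow_sub_one_smul hπ.nsmul_eq_zero]
          exact pow_smul_eq_zero hπ hd (by omega)
        obtain ⟨c, hc⟩ := h.exists_sub_nsmul_map_mem_of_fixed hπ hi' hfix hfixd hd.1
        exact ⟨c, hc, Or.inr hL⟩
    obtain ⟨t, ht, hta⟩ := hca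
    have hat : π a = π t + c • π d := by rw [hta, map_sub, map_nsmul, sub_add_cancel]
    have hc0 : (X - 1 : ℤ[X]) ^ (l + 1) • c • π d = 0 := by
      rcases hc with rfl | hc
      · rw [zero_smul, smul_zero]
      · rw [smul_nsmul_comm, pow_smul_eq_zero hπ hd (by omega), smul_zero]
    obtain ⟨c', v, hv, hvt⟩ := h.exists_pow_smul_map_eq_add_nsmul_root hπ hi hl ht (by
      rw [hat, smul_add, hc0, add_zero] at hy; exact hy)
    have hv' : v + c' • π ξ ∈ normImage p π (i + 1) :=
      add_mem hv (nsmul_mem (h.map_root_mem_normImage hi') c')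
    by_cases hlt : PowerClasses.powBot p m < l
    · refine ⟨0, _, hv', ?_, fun _ => rfl⟩
      rw [hat, smul_add, hvt, smul_nsmul_comm, pow_smul_eq_zero hπ hd hlt, smul_zero, zero_smul]
    · refine ⟨c, _, hv', ?_, fun hlt' => absurd hlt' hlt⟩
      rw [hat, smul_add, hvt, smul_nsmul_comm]
      rcases hc with rfl | hc
      · rw [zero_smul, zero_smul]
      · rw [show PowerClasses.powBot p m = l by omega]
  · subst hin
    obtain ⟨c, v, hv, hva⟩ := h.exists_pow_smul_map_eq_add_nsmul_root hπ hi hl (h.mem_top a) hy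
    rcases lt_or_ge m i with hmi | hmi
    · have hfixd : (X ^ p ^ i - 1 : ℤ[X]) • π d = 0 := by
        rw [X_pow_sub_one_smul hπ.nsmul_eq_zero]
        refine pow_smul_eq_zero hπ hd ?_
        cases m with
        | bot => exact pow_pos hp.out.pos i
        | coe k => exact Nat.pow_lt_pow_right hp.out.one_lt (WithBot.coe_lt_coe.1 hmi)
      obtain ⟨b, hb⟩ := h.exists_normPoly_smul_eq_root_of_fixed hπ hi hfixd hd.1
      obtain ⟨g, -, u, hu, hgu⟩ := h.exists_of_normPoly_smul_mem (Nat.le_succ i) le_rfl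
        (h.mem_top b) (hb ▸ h.root_mem 0)
      have hξ : π ξ ∈ normImage p π (i + 1) := by
        refine mem_normImage.2 ⟨u, hu, ?_⟩
        rw [← hb, hgu, Nat.succ_sub (le_refl i), Nat.sub_self, pow_one, map_add,
          hπ.map_nsmul_self, zero_add]
      exact ⟨0, _, add_mem hv (nsmul_mem hξ c), by rw [hva, zero_smul, add_zero], fun _ => rfl⟩
    · obtain rfl : m = i := by
        refine le_antisymm ?_ hmi
        cases m with
        | bot => exact bot_le
        | coe k => exact WithBot.coe_le_coe.2 (Nat.lt_succ_iff.1 (WithBot.coe_lt_coe.1 hmn))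
      change ∃ c : ℕ, ∃ v ∈ normImage p π (i + 1),
        (X - 1 : ℤ[X]) ^ l • π a = v + c • (X - 1 : ℤ[X]) ^ (p ^ i) • π d ∧ (p ^ i < l → c = 0)
      have hnot : (X - 1 : ℤ[X]) ^ (p ^ i) • π d ∉ normImage p π (i + 1) :=
        h.socle_notMem_normImage hπ hm hd hmn le_rfl
      obtain ⟨c₁, v₁, hv₁, hd₁⟩ := h.exists_pow_smul_map_eq_add_nsmul_root hπ hi le_rfl
        (h.mem_top d) (pow_smul_eq_zero hπ hd (Nat.lt_succ_self _))
      have hc₁ : c₁ • ξ ≠ 0 := by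
        intro h0
        rw [← map_nsmul, h0, map_zero, add_zero] at hd₁
        exact hnot (hd₁ ▸ hv₁)
      -- The same relation for d has a nonzero coefficient of [ξ], because e is not in the norm
      -- image; solving it expresses [ξ] through e.
      obtain ⟨r, hr⟩ := h.exists_nsmul_nsmul_root hc₁
      have hξ : π ξ = r • (X - 1 : ℤ[X]) ^ (p ^ i) • π d - r • v₁ := by
        rw [hd₁, smul_add, ← map_nsmul π, ← map_nsmul π, hr]; abel
      have hva' : (X - 1 : ℤ[X]) ^ l • π a =
          (v - c • r • v₁) + (c * r) • (X - 1 : ℤ[X]) ^ (p ^ i) • π d := by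
        rw [hva, hξ, mul_smul, smul_sub]; abel
      have hv' : v - c • r • v₁ ∈ normImage p π (i + 1) :=
        sub_mem hv (nsmul_mem (nsmul_mem hv₁ r) c)
      by_cases hpc : p ∣ c * r
      · refine ⟨0, _, hv', ?_, fun _ => rfl⟩
        obtain ⟨s, hs⟩ := hpc
        rw [hva', hs, mul_smul, hπ.nsmul_eq_zero, zero_smul]
      · refine ⟨_, _, hv', hva', fun hlt => ?_⟩
        exfalso
        obtain ⟨u, hu, huv⟩ := mem_normImage.1 hv'
        rw [← huv] at hva'
        -- This class is fixed at level i ≤ m, so its norm class is trivial. For l > p^i so are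
        -- those of the terms in a and u, leaving a multiple of d prime to p.
        have h1 : (X ^ p ^ i - 1 : ℤ[X]) • π ((X - 1 : ℤ[X]) ^ (l - p ^ i) • a -
            (X - 1 : ℤ[X]) ^ (p ^ (i + 1) - 1 - p ^ i) • u - (c * r) • d) = 0 := by
          rw [X_pow_sub_one_smul hπ.nsmul_eq_zero, map_sub, map_sub, smul_sub, smul_sub, map_smul,
            map_smul, map_nsmul, smul_smul, smul_smul, ← pow_add, ← pow_add,
            Nat.add_sub_cancel' hl, hva', map_smul, normPoly_zero_smul hπ.nsmul_eq_zero,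
            show p ^ i + (p ^ (i + 1) - 1 - p ^ i) = p ^ (i + 1) - 1 by omega, smul_nsmul_comm]
          abel
        have h2 := h.mem_trivialNorm_of_map_mem hπ hi (h.map_mem_of_fixed_of_le hπ hm le_rfl h1)
        refine hd.1 (h.mem_trivialNorm_of_nsmul hπ hpc ?_)
        have h3 := sub_mem (sub_mem (h.X_sub_one_pow_smul_mem_trivialNorm
          (show l - p ^ i ≠ 0 by omega) a) (h.X_sub_one_pow_smul_mem_trivialNorm
          (show p ^ (i + 1) - 1 - p ^ i ≠ 0 by omega) u)) h2
        rwa [sub_sub_cancel] at h3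

end Minimal

end IsKummerTower

/-! ### The Jordan basis in the abstract setting. -/

namespace IsKummerTower

variable {p n : ℕ} [hp : Fact p.Prime] {A J : Type*} [AddCommGroup A] [Module ℤ[X] A] {ξ : A}
  [AddCommGroup J] [Module ℤ[X] J] {π : A →ₗ[ℤ[X]] J}

theorem pow_apply_eq_smul [Module (ZMod p) J] {N : Module.End (ZMod p) J}
    (hN : ∀ y, N y = (X - 1 : ℤ[X]) • y) (r : ℕ) (y : J) :
    (N ^ r) y = (X - 1 : ℤ[X]) ^ r • y := by
  induction r generalizing y with
  | zero => simp
  | succ r ih => rw [pow_succ, Module.End.mul_apply, ih, hN, smul_smul, ← pow_succ]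

variable (h : IsKummerTower p n ξ) (hπ : IsModP p π)
  {m : WithBot ℕ} (hm : IsLeast {i : WithBot ℕ | i ≤ n ∧ ∃ d, IsNormAdmissible p n π i d} m)
  {d : A} (hd : IsNormAdmissible p n π m d)

include h hπ hd

omit hp in
-- The norm class vanishes on level i < n and on multiples of X - 1, but not on d.
theorem smul_eq_zero_of_add_mem_levelImage [Fact p.Prime] [Module (ZMod p) J] {i : ℕ} (hi : i < n)
    {c : ZMod p} {y : J}
    (hy : c • π d + (X - 1 : ℤ[X]) • y ∈ (levelSubmodule p A i).map π) : c = 0 := by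
  obtain ⟨a, rfl⟩ := hπ.surjective y
  have hc : c • π d = π (c.val • d) := by
    rw [map_nsmul, ← Nat.cast_smul_eq_nsmul (ZMod p), ZMod.natCast_zmod_val]
  rw [hc, ← map_smul, ← map_add] at hy
  have h1 := sub_mem (h.mem_trivialNorm_of_map_mem hπ hi hy) (h.X_sub_one_smul_mem_trivialNorm a)
  rw [add_sub_cancel_right] at h1
  by_contra hc0
  refine hd.1 (h.mem_trivialNorm_of_nsmul hπ (fun hdvd => hc0 ?_) h1)
  rw [← ZMod.natCast_zmod_val c]
  exact (ZMod.natCast_eq_zero_iff _ _).2 hdvd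

include hm

/-- The Jordan string basis of the power classes. -/
theorem exists_jordanBasis [Module (ZMod p) J] {N : Module.End (ZMod p) J}
    (hN : ∀ y, N y = (X - 1 : ℤ[X]) • y) :
    ∃ (S : Set J) (o : S) (lv : S → ℕ) (x : S → J) (l : S → ℕ),
      x o = π d ∧ l o = PowerClasses.powBot p m + 1 ∧
      (∀ b, b ≠ o → lv b ≤ n ∧ l b = p ^ lv b ∧ x b ∈ (levelSubmodule p A (lv b)).map π) ∧
      (∀ b, (N ^ l b) (x b) = 0) ∧ LinearIndependent (ZMod p) (jordanString N x l) ∧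
      Submodule.span (ZMod p) (Set.range (jordanString N x l)) = ⊤ := by
  classical
  let U : ℕ → Submodule (ZMod p) J := fun i =>
    AddSubgroup.toZModSubmodule p (normImage p π i).toAddSubgroup
  set e : J := (X - 1 : ℤ[X]) ^ PowerClasses.powBot p m • π d with he
  have hU : ∀ i y, y ∈ U i ↔ y ∈ normImage p π i := fun _ _ => Iff.rfl
  have hNr : ∀ r y, (N ^ r) y = (X - 1 : ℤ[X]) ^ r • y := pow_apply_eq_smul hN
  obtain ⟨S, lv, hS, heS, hlv, hsp⟩ :=
    exists_adapted_linearIndepOn (n + 1) U (h.socle_ne_zero hπ hm hd)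
  have hch : ∀ b : S, ∃ t, b.1 ≠ e →
      t ∈ levelSubmodule p A (lv b) ∧ π (normPoly p (lv b) 0 • t) = b.1 := by
    intro b
    by_cases hb : b.1 = e
    · exact ⟨0, fun h => absurd hb h⟩
    · obtain ⟨t, ht⟩ := mem_normImage.1 ((hlv b.1 b.2 hb).2)
      exact ⟨t, fun _ => ht⟩
  choose t ht using hch
  let o : S := ⟨e, heS⟩
  have hne : ∀ b : S, b ≠ o → b.1 ≠ e := fun b hb hbe => hb (Subtype.ext hbe)
  let x : S → J := fun b => if b = o then π d else π (t b)
  let l : S → ℕ := fun b => if b = o then PowerClasses.powBot p m + 1 else p ^ lv b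
  have hxo : x o = π d := if_pos rfl
  have hlo : l o = PowerClasses.powBot p m + 1 := if_pos rfl
  have hxb : ∀ b, b ≠ o → x b = π (t b) := fun b hb => if_neg hb
  have hlb : ∀ b, b ≠ o → l b = p ^ lv b := fun b hb => if_neg hb
  have htop : ∀ b, (N ^ (l b - 1)) (x b) = b.1 := by
    intro b
    rw [hNr]
    by_cases hb : b = o
    · rw [hb, hxo, hlo, Nat.add_sub_cancel]
    · rw [hxb b hb, hlb b hb, ← normPoly_zero_smul hπ.nsmul_eq_zero, ← map_smul,
        (ht b (hne b hb)).2]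
  have hzero : ∀ b, (N ^ l b) (x b) = 0 := by
    intro b
    rw [hNr]
    by_cases hb : b = o
    · rw [hb, hxo, hlo, pow_succ_smul_eq_zero hπ hd]
    · rw [hxb b hb, hlb b hb, ← X_pow_sub_one_smul hπ.nsmul_eq_zero, ← map_smul,
        mem_levelSubmodule.1 (ht b (hne b hb)).1, map_zero]
  have hli : LinearIndependent (ZMod p) fun b => (N ^ (l b - 1)) (x b) := by
    simp only [htop]
    exact hS
  refine ⟨S, o, fun b => lv b, x, l, hxo, hlo, fun b hb => ?_, hzero,
    linearIndependent_jordanString hzero hli, ?_⟩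
  · refine ⟨Nat.lt_succ_iff.1 (hlv b.1 b.2 (hne b hb)).1, hlb b hb, ?_⟩
    rw [hxb b hb]
    exact ⟨t b, (ht b (hne b hb)).1, rfl⟩
  have hNn : N ^ p ^ n = 0 := by
    ext y
    obtain ⟨a, rfl⟩ := hπ.surjective y
    rw [hNr, ← X_pow_sub_one_smul hπ.nsmul_eq_zero, ← map_smul,
      mem_levelSubmodule.1 (h.mem_top a), map_zero, LinearMap.zero_apply]
  refine span_jordanString_eq_top hNn fun r v hv => ?_
  simp only [htop]
  set W := Submodule.span (ZMod p) {w | ∃ b : S, r < l b ∧ w = b.1} with hW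
  have heW : r ≤ PowerClasses.powBot p m → e ∈ W := fun hr =>
    Submodule.subset_span ⟨o, by rw [hlo]; omega, rfl⟩
  have hSW : ∀ i, r < p ^ i → ∀ w ∈ S, w ≠ e → i ≤ lv w → w ∈ W := by
    intro i hri w hw hwe hiw
    have hwo : (⟨w, hw⟩ : S) ≠ o := fun hwo => hwe (congrArg Subtype.val hwo)
    refine Submodule.subset_span ⟨⟨w, hw⟩, ?_, rfl⟩
    rw [hlb _ hwo]
    exact hri.trans_le (Nat.pow_le_pow_right hp.out.pos hiw)
  have hUW : ∀ i, r < p ^ i → i ≤ n → r ≤ PowerClasses.powBot p m → U i ≤ W := by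
    intro i hri hi hr
    refine (hsp i (by omega)).trans (Submodule.span_le.2 ?_)
    rintro w (rfl | ⟨hw, hwe, hiw⟩)
    · exact heW hr
    · exact hSW i hri w hw hwe hiw
  rw [hNr]
  rw [hNr] at hv
  rcases Nat.eq_zero_or_pos r with hr0 | hr0
  · subst hr0
    rw [zero_add, pow_one] at hv
    obtain ⟨c, w, hw, rfl⟩ := h.exists_eq_add_nsmul_socle_of_fixed hπ hm hd hv
    rw [pow_zero, one_smul]
    exact add_mem (hUW 0 (by simp) (Nat.zero_le n) (Nat.zero_le _) hw)
      (nsmul_mem (heW (Nat.zero_le _)) c)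
  rcases le_or_gt (p ^ n) r with hrn | hrn
  · rw [← hNr, ← Nat.sub_add_cancel hrn, pow_add, hNn, mul_zero]
    exact zero_mem _
  have hlog1 := Nat.pow_log_le_self p hr0.ne'
  have hlog2 := Nat.lt_pow_succ_log_self hp.out.one_lt r
  set i := Nat.log p r
  have hi : i + 1 ≤ n := (Nat.pow_lt_pow_iff_right hp.out.one_lt).1 (hlog1.trans_lt hrn)
  obtain ⟨c, w, hw, hvw, hc⟩ := h.exists_pow_smul_eq_add_nsmul_socle hπ hm hd hi hlog1 hlog2 hv
  rw [hvw]
  rcases le_or_gt r (PowerClasses.powBot p m) with hrm | hrm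
  · exact add_mem (hUW (i + 1) hlog2 hi hrm hw) (nsmul_mem (heW hrm) c)
  · rw [hc hrm, zero_smul, add_zero]
    have hmi : m < ((i + 1 : ℕ) : WithBot ℕ) := by
      cases m with
      | bot => exact WithBot.bot_lt_coe _
      | coe k =>
        exact WithBot.coe_lt_coe.2 ((Nat.pow_lt_pow_iff_right hp.out.one_lt).1 (hrm.trans hlog2))
    -- The adapted basis bounds U (i + 1) only by a span containing e. Since m < i + 1, e is not in
    -- U (i + 1), so its coefficient vanishes.
    obtain ⟨a, z, hz, hwz⟩ := Submodule.mem_span_insert.1 (hsp (i + 1) (by omega) hw)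
    have hzU : z ∈ U (i + 1) := by
      refine Submodule.span_le.2 ?_ hz
      rintro s ⟨hs, hse, hsi⟩
      exact normImage_anti hsi (hlv s hs hse).2
    have ha : a = 0 := by
      by_contra ha
      have h1 : a • e ∈ U (i + 1) := by
        rw [show a • e = w - z by rw [hwz, add_sub_cancel_right]]
        exact sub_mem hw hzU
      have h2 : e ∈ U (i + 1) := (Submodule.smul_mem_iff _ ha).1 h1
      exact h.socle_notMem_normImage hπ hm hd hmi hi h2
    rw [hwz, ha, zero_smul, zero_add]
    refine Submodule.span_le.2 ?_ hz
    rintro s ⟨hs, hse, hsi⟩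
    exact hSW (i + 1) hlog2 s hs hse hsi

end IsKummerTower

/-! ### Hilbert 90 for the steps of the tower. -/

section Hilbert90

variable {F K : Type*} [Field F] [Field K] [Algebra F K]

/-- Hilbert's Theorem 90 for the automorphism of an intermediate field induced by `τ`. -/
theorem exists_apply_eq_mul_of_prod_eq_one (E : IntermediateField F K) (τ : K ≃ₐ[F] K) {d : ℕ}
    (hd : 0 < d) (hE : ∀ x ∈ E, τ x ∈ E) (hord : ∀ x ∈ E, (τ ^ d) x = x)
    (hinj : ∀ s < d, ∀ s' < d, (∀ x ∈ E, (τ ^ s) x = (τ ^ s') x) → s = s')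
    {a : K} (ha : a ∈ E) (hprod : ∏ s ∈ Finset.range d, (τ ^ s) a = 1) :
    ∃ b ∈ E, b ≠ 0 ∧ a * τ b = b := by
  have hEpow : ∀ s, ∀ x ∈ E, (τ ^ s) x ∈ E := by
    intro s
    induction s with
    | zero => exact fun x hx => hx
    | succ s ih => exact fun x hx => by rw [pow_succ]; exact ih _ (hE x hx)
  let χ : Fin d → (E →* K) := fun s =>
    ((τ ^ (s : ℕ) : K ≃ₐ[F] K) : K →* K).comp (E.val : E →* K)
  have hχ : Function.Injective χ := fun s s' hss => Fin.ext <|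
    hinj s s.2 s' s'.2 fun x hx => DFunLike.congr_fun hss ⟨x, hx⟩
  have hli := (linearIndependent_monoidHom E K).comp χ hχ
  let c : ℕ → K := fun s => ∏ r ∈ Finset.range s, (τ ^ r) a
  have hc : ∀ s, c s ∈ E := fun s => prod_mem fun r _ => hEpow r a ha
  have hcs : ∀ s, a * τ (c s) = c (s + 1) := by
    intro s
    simp only [c]
    rw [Finset.prod_range_succ', map_prod, mul_comm]
    simp only [pow_succ', AlgEquiv.mul_apply, pow_zero, AlgEquiv.one_apply]
  -- Lagrange resolvent with coefficients the partial norms of a; it is nonzero for some y by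
  -- independence of characters.
  obtain ⟨y, hy⟩ : ∃ y : E, ∑ s : Fin d, c s * χ s y ≠ 0 := by
    by_contra! hall
    have h0 := Fintype.linearIndependent_iff.1 hli (fun s => c s) (by
      ext y
      simpa [Finset.sum_apply] using hall y) ⟨0, hd⟩
    simp [c] at h0
  have hy' : ∑ s : Fin d, c s * χ s y = ∑ s ∈ Finset.range d, c s * (τ ^ s) y :=
    Fin.sum_univ_eq_sum_range (fun s => c s * (τ ^ s) (y : K)) d
  rw [hy'] at hy
  refine ⟨_, sum_mem fun s _ => mul_mem (hc s) (hEpow s y y.2), hy, ?_⟩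
  have h1 : ∀ s, a * τ (c s * (τ ^ s) y) = c (s + 1) * (τ ^ (s + 1)) y := by
    intro s
    rw [map_mul, ← mul_assoc, hcs, pow_succ', AlgEquiv.mul_apply]
  rw [map_sum, Finset.mul_sum, Finset.sum_congr rfl fun s _ => h1 s]
  have h2 := Finset.sum_range_succ' (fun s => c s * (τ ^ s) (y : K)) d
  rw [Finset.sum_range_succ] at h2
  have h3 : c d * (τ ^ d) (y : K) = c 0 * (τ ^ 0) (y : K) := by
    rw [hord y y.2, show c d = 1 from hprod]
    simp [c]
  rw [h3] at h2
  exact (add_right_cancel h2).symm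

end Hilbert90

/-! ### Galois theory of a cyclic extension of degree p^n. -/

section CyclicGalois

variable {F K : Type*} [Field F] [Field K] [Algebra F K] [FiniteDimensional F K] [IsGalois F K]
  {p n : ℕ} {σ : K ≃ₐ[F] K}

omit [FiniteDimensional F K] [IsGalois F K] in
theorem orderOf_eq_of_generates (hσ : ∀ τ : K ≃ₐ[F] K, τ ∈ Subgroup.zpowers σ)
    (hG : Nat.card (K ≃ₐ[F] K) = p ^ n) : orderOf σ = p ^ n := by
  rw [← hG, orderOf_eq_card_of_forall_mem_zpowers hσ]

theorem card_fixingSubgroup_of_finrank (hp : p.Prime) (hG : Nat.card (K ≃ₐ[F] K) = p ^ n)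
    {E : IntermediateField F K} {i : ℕ} (hi : i ≤ n) (hE : Module.finrank F E = p ^ i) :
    Nat.card E.fixingSubgroup = p ^ (n - i) := by
  rw [IsGalois.card_fixingSubgroup_eq_finrank]
  apply Nat.eq_of_mul_eq_mul_left (pow_pos hp.pos i)
  rw [← pow_add, Nat.add_sub_cancel' hi, ← hG, IsGalois.card_aut_eq_finrank, ← hE,
    Module.finrank_mul_finrank]

theorem pow_mem_fixingSubgroup_iff (hp : p.Prime)
    (hσ : ∀ τ : K ≃ₐ[F] K, τ ∈ Subgroup.zpowers σ)
    (hG : Nat.card (K ≃ₐ[F] K) = p ^ n) {E : IntermediateField F K} {i : ℕ} (hi : i ≤ n)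
    (hE : Module.finrank F E = p ^ i) (r : ℕ) : σ ^ r ∈ E.fixingSubgroup ↔ p ^ i ∣ r := by
  have hord := orderOf_eq_of_generates hσ hG
  have hcard := card_fixingSubgroup_of_finrank hp hG hi hE
  have h1 : ∀ r, σ ^ r ∈ E.fixingSubgroup → p ^ i ∣ r := by
    intro r hr
    have h2 : (σ ^ r) ^ p ^ (n - i) = 1 := by
      rw [← hcard]
      exact congrArg Subtype.val (pow_card_eq_one' (x := (⟨σ ^ r, hr⟩ : E.fixingSubgroup)))
    rw [← pow_mul, ← orderOf_dvd_iff_pow_eq_one, hord, ← Nat.add_sub_cancel' hi, pow_add,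
      Nat.add_sub_cancel_left] at h2
    exact Nat.dvd_of_mul_dvd_mul_right (pow_pos hp.pos _) h2
  have hle : E.fixingSubgroup ≤ Subgroup.zpowers (σ ^ p ^ i) := by
    intro τ hτ
    obtain ⟨r, rfl⟩ := (mem_powers_iff_mem_zpowers (x := σ)).2 (hσ τ)
    obtain ⟨s, rfl⟩ := h1 r hτ
    change σ ^ _ ∈ _
    rw [pow_mul]
    exact Subgroup.npow_mem_zpowers _ _
  have heq : E.fixingSubgroup = Subgroup.zpowers (σ ^ p ^ i) := by
    apply Subgroup.eq_of_le_of_card_ge hle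
    rw [hcard, Nat.card_zpowers, orderOf_pow_of_dvd (pow_pos hp.pos i).ne'
      (by rw [hord]; exact pow_dvd_pow p hi), hord, Nat.pow_div hi hp.pos]
  refine ⟨h1 r, ?_⟩
  rintro ⟨s, rfl⟩
  rw [heq, pow_mul]
  exact Subgroup.npow_mem_zpowers _ _

theorem mem_iff_pow_apply_eq (hp : p.Prime)
    (hσ : ∀ τ : K ≃ₐ[F] K, τ ∈ Subgroup.zpowers σ)
    (hG : Nat.card (K ≃ₐ[F] K) = p ^ n) {E : IntermediateField F K} {i : ℕ} (hi : i ≤ n)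
    (hE : Module.finrank F E = p ^ i) (x : K) : x ∈ E ↔ (σ ^ p ^ i) x = x := by
  have hmem := pow_mem_fixingSubgroup_iff hp hσ hG hi hE
  constructor
  · intro hx
    exact (IntermediateField.mem_fixingSubgroup_iff _ _).1 ((hmem _).2 dvd_rfl) x hx
  · intro hx
    rw [← IsGalois.fixedField_fixingSubgroup E, IntermediateField.mem_fixedField_iff]
    intro τ hτ
    obtain ⟨r, rfl⟩ := (mem_powers_iff_mem_zpowers (x := σ)).2 (hσ τ)
    obtain ⟨s, rfl⟩ := (hmem r).1 hτ
    change (σ ^ (p ^ i * s)) x = x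
    rw [pow_mul]
    induction s with
    | zero => rfl
    | succ s ih =>
      rw [pow_succ, AlgEquiv.mul_apply, hx]
      exact ih ((hmem _).2 (dvd_mul_right _ _))

theorem algebraMap_norm_eq_prod (hσ : ∀ τ : K ≃ₐ[F] K, τ ∈ Subgroup.zpowers σ)
    (hG : Nat.card (K ≃ₐ[F] K) = p ^ n) (x : K) :
    algebraMap F K (Algebra.norm F x) = ∏ s ∈ Finset.range (p ^ n), (σ ^ s) x := by
  classical
  rw [Algebra.norm_eq_prod_automorphisms, ← IsCyclic.image_range_orderOf hσ,
    Finset.prod_image, orderOf_eq_of_generates hσ hG]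
  intro a ha b hb hab
  exact pow_injOn_Iio_orderOf (by simpa using ha) (by simpa using hb) hab

end CyclicGalois

/-! ### The multiplicative group of K as a Kummer tower. -/

/-- The multiplicative group of `K`, written additively, on which `X` acts as `σ`. -/
def GaloisUnits {F K : Type*} [Field F] [Field K] [Algebra F K] (_ : K ≃ₐ[F] K) : Type _ :=
  Additive Kˣ

namespace GaloisUnits

variable {F K : Type*} [Field F] [Field K] [Algebra F K] (σ : K ≃ₐ[F] K)

instance : AddCommGroup (GaloisUnits σ) := inferInstanceAs (AddCommGroup (Additive Kˣ))

/-- The action of `σ`. -/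
def frob : AddMonoid.End (GaloisUnits σ) :=
  MonoidHom.toAdditive (Units.map (σ : K →* K))

noncomputable instance : Module ℤ[X] (GaloisUnits σ) :=
  Module.compHom _ (aeval (R := ℤ) (frob σ)).toRingHom

variable {σ}

/-- The unit of `K` underlying an element. -/
def unit (a : GaloisUnits σ) : Kˣ := Additive.toMul a

/-- The element given by a unit of `K`. -/
def ofUnit (σ : K ≃ₐ[F] K) (u : Kˣ) : GaloisUnits σ := Additive.ofMul u

theorem unit_ofUnit (u : Kˣ) : unit (ofUnit σ u) = u := rfl

theorem ext {a b : GaloisUnits σ} (h : (unit a : K) = unit b) : a = b :=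
  congrArg Additive.ofMul (Units.ext h : unit a = unit b)

theorem unit_zero : unit (0 : GaloisUnits σ) = 1 := rfl

theorem unit_add (a b : GaloisUnits σ) : unit (a + b) = unit a * unit b := rfl

theorem unit_nsmul (r : ℕ) (a : GaloisUnits σ) : unit (r • a) = unit a ^ r := rfl

theorem unit_sum {ι : Type*} (s : Finset ι) (f : ι → GaloisUnits σ) :
    unit (∑ i ∈ s, f i) = ∏ i ∈ s, unit (f i) := rfl

theorem coe_unit_X_smul (a : GaloisUnits σ) : (unit ((X : ℤ[X]) • a) : K) = σ (unit a) := by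
  change (unit ((aeval (R := ℤ) (frob σ)) X a) : K) = _
  rw [aeval_X]
  rfl

theorem coe_unit_X_pow_smul (r : ℕ) (a : GaloisUnits σ) :
    (unit ((X : ℤ[X]) ^ r • a) : K) = (σ ^ r) (unit a) := by
  induction r with
  | zero => simp
  | succ r ih => rw [pow_succ', mul_smul, coe_unit_X_smul, ih, pow_succ', AlgEquiv.mul_apply]

theorem coe_unit_normPoly_smul (p i j : ℕ) (a : GaloisUnits σ) :
    (unit (normPoly p i j • a) : K) = ∏ s ∈ Finset.range (p ^ (i - j)), ((σ ^ p ^ j) ^ s) (unit a) := by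
  rw [normPoly, Finset.sum_smul, unit_sum, Units.coe_prod]
  refine Finset.prod_congr rfl fun s _ => ?_
  rw [← pow_mul, coe_unit_X_pow_smul, pow_mul]

theorem X_pow_sub_one_smul_eq_iff {r : ℕ} {a b : GaloisUnits σ} :
    (X ^ r - 1 : ℤ[X]) • a = b ↔ (σ ^ r) (unit a : K) = unit b * unit a := by
  rw [sub_smul, one_smul, sub_eq_iff_eq_add]
  constructor
  · intro h
    rw [← coe_unit_X_pow_smul, h, unit_add, Units.val_mul]
  · intro h
    apply ext
    rw [coe_unit_X_pow_smul, h, unit_add, Units.val_mul]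

theorem mem_levelSubmodule_iff {p i : ℕ} {a : GaloisUnits σ} :
    a ∈ levelSubmodule p (GaloisUnits σ) i ↔ (σ ^ p ^ i) (unit a : K) = unit a := by
  rw [mem_levelSubmodule, X_pow_sub_one_smul_eq_iff, unit_zero, Units.val_one, one_mul]

variable [FiniteDimensional F K] [IsGalois F K] {p n : ℕ}

theorem mem_levelSubmodule_iff_mem (hp : p.Prime) (hσ : ∀ τ : K ≃ₐ[F] K, τ ∈ Subgroup.zpowers σ)
    (hG : Nat.card (K ≃ₐ[F] K) = p ^ n) {E : IntermediateField F K} {i : ℕ} (hi : i ≤ n)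
    (hE : Module.finrank F E = p ^ i) {a : GaloisUnits σ} :
    a ∈ levelSubmodule p (GaloisUnits σ) i ↔ (unit a : K) ∈ E := by
  rw [mem_levelSubmodule_iff, mem_iff_pow_apply_eq hp hσ hG hi hE]

theorem unit_normPoly_eq_norm (hσ : ∀ τ : K ≃ₐ[F] K, τ ∈ Subgroup.zpowers σ)
    (hG : Nat.card (K ≃ₐ[F] K) = p ^ n) (a : GaloisUnits σ) :
    (unit (normPoly p n 0 • a) : K) = algebraMap F K (Algebra.norm F (unit a : K)) := by
  rw [coe_unit_normPoly_smul, algebraMap_norm_eq_prod hσ hG, pow_zero, pow_one, Nat.sub_zero]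

theorem mem_levelSubmodule_zero_iff (hσ : ∀ τ : K ≃ₐ[F] K, τ ∈ Subgroup.zpowers σ)
    {a : GaloisUnits σ} :
    a ∈ levelSubmodule p (GaloisUnits σ) 0 ↔ ∃ f : Fˣ, algebraMap F K f = unit a := by
  rw [mem_levelSubmodule_iff, pow_zero, pow_one]
  constructor
  · intro h
    have h1 : (unit a : K) ∈ (⊥ : IntermediateField F K) := by
      rw [IsGalois.mem_bot_iff_fixed]
      intro τ
      obtain ⟨r, rfl⟩ := (mem_powers_iff_mem_zpowers (x := σ)).2 (hσ τ)
      change (σ ^ r) _ = _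
      induction r with
      | zero => rfl
      | succ r ih => rw [pow_succ, AlgEquiv.mul_apply, h, ih]
    obtain ⟨f, hf⟩ := IntermediateField.mem_bot.1 h1
    refine ⟨Units.mk0 f ?_, hf⟩
    rintro rfl
    exact (unit a).ne_zero (by rw [← hf, map_zero])
  · rintro ⟨f, hf⟩
    rw [← hf, AlgEquiv.commutes]

theorem isKummerTower (hp : p.Prime) (hn : 1 ≤ n)
    (hσ : ∀ τ : K ≃ₐ[F] K, τ ∈ Subgroup.zpowers σ) (hG : Nat.card (K ≃ₐ[F] K) = p ^ n)
    (E : ℕ → IntermediateField F K) (hE : ∀ i ≤ n, Module.finrank F (E i) = p ^ i)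
    {ξ : F} (hξ : IsPrimitiveRoot ξ p) (h2 : p = 2 → 1 < n ∨ ∃ x : Kˣ, Algebra.norm F (x : K) = -1)
    {ζ : Kˣ} (hζ : (ζ : K) = algebraMap F K ξ) : IsKummerTower p n (ofUnit σ ζ) := by
  have hζp : IsPrimitiveRoot (ζ : K) p := hζ ▸ hξ.map_of_injective (algebraMap F K).injective
  have hnp : NeZero p := ⟨hp.ne_zero⟩
  refine ⟨hn, fun a => ?_, fun i j hji hi a ha hn => ?_, fun h0 => ?_, ?_, ?_, fun a ha => ?_,
    fun hp2 => (h2 hp2).imp_right ?_⟩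
  · rw [mem_levelSubmodule_iff, ← orderOf_eq_of_generates hσ hG, pow_orderOf_eq_one]
    rfl
  · have hmem : ∀ x, x ∈ E i ↔ (σ ^ p ^ i) x = x := mem_iff_pow_apply_eq hp hσ hG hi (hE i hi)
    have hji' : p ^ j * p ^ (i - j) = p ^ i := by rw [← pow_add, Nat.add_sub_cancel' hji]
    have hn' : ∏ s ∈ Finset.range (p ^ (i - j)), ((σ ^ p ^ j) ^ s) (unit a : K) = 1 := by
      rw [← coe_unit_normPoly_smul, hn, unit_zero, Units.val_one]
    have hdvd : ∀ s s' : ℕ, s ≤ s' → s' < p ^ (i - j) →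
        (∀ x ∈ E i, ((σ ^ p ^ j) ^ s) x = ((σ ^ p ^ j) ^ s') x) → s = s' := by
      intro s s' hss hs' hx
      have h1 : σ ^ (p ^ j * (s' - s)) ∈ (E i).fixingSubgroup := by
        rw [IntermediateField.mem_fixingSubgroup_iff]
        intro x hxE
        apply ((σ ^ p ^ j) ^ s).injective
        rw [hx x hxE, pow_mul, ← AlgEquiv.mul_apply, ← pow_add, Nat.add_sub_cancel' hss]
      rw [pow_mem_fixingSubgroup_iff hp hσ hG hi (hE i hi), ← hji'] at h1
      have := Nat.eq_zero_of_dvd_of_lt (Nat.dvd_of_mul_dvd_mul_left (pow_pos hp.pos j) h1)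
        (by omega)
      omega
    obtain ⟨b, hbE, hb0, hb⟩ := exists_apply_eq_mul_of_prod_eq_one (E i) (σ ^ p ^ j)
      (pow_pos hp.pos (i - j))
      (fun x hx => by
        rw [hmem] at hx ⊢
        rw [← AlgEquiv.mul_apply, ← pow_add, add_comm, pow_add, AlgEquiv.mul_apply, hx])
      (fun x hx => by rw [← pow_mul, hji']; exact (hmem x).1 hx)
      (fun s hs s' hs' hx => by
        rcases le_total s s' with hss | hss
        · exact hdvd s s' hss hs' hx
        · exact (hdvd s' s hss hs fun x hxE => (hx x hxE).symm).symm)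
      ((mem_levelSubmodule_iff_mem hp hσ hG hi (hE i hi)).1 ha) hn'
    -- The inverse appears because the field version gives a τ(b) = b, whereas τ(c)/c = a is wanted.
    refine ⟨ofUnit σ (Units.mk0 b hb0)⁻¹, ?_, ?_⟩
    · rw [mem_levelSubmodule_iff_mem hp hσ hG hi (hE i hi), unit_ofUnit, Units.val_inv_eq_inv_val]
      exact inv_mem hbE
    · rw [X_pow_sub_one_smul_eq_iff, unit_ofUnit, Units.val_inv_eq_inv_val, Units.val_mk0,
        map_inv₀]
      have hτb : (σ ^ p ^ j) b ≠ 0 := (map_ne_zero (σ ^ p ^ j)).2 hb0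
      field_simp
      rw [mul_comm, hb]
  · exact hζp.ne_one hp.one_lt (congrArg (fun a => ((unit a : Kˣ) : K)) h0)
  · apply ext
    rw [unit_nsmul, Units.val_pow_eq_pow_val, unit_ofUnit, hζp.pow_eq_one, unit_zero, Units.val_one]
  · have := X_pow_sub_one_smul_eq_iff (r := 1) (a := ofUnit σ ζ) (b := 0)
    rw [pow_one] at this
    rw [this, pow_one, unit_zero, unit_ofUnit, hζ, AlgEquiv.commutes, Units.val_one, one_mul]
  · obtain ⟨c, -, hc⟩ := hζp.eq_pow_of_pow_eq_one (ξ := (unit a : K)) (by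
      rw [← Units.val_pow_eq_pow_val, ← unit_nsmul, ha, unit_zero, Units.val_one])
    refine ⟨c, ext ?_⟩
    rw [unit_nsmul, unit_ofUnit, Units.val_pow_eq_pow_val, hc]
  · rintro ⟨x, hx⟩
    subst hp2
    refine ⟨ofUnit σ x, ext ?_⟩
    rw [unit_normPoly_eq_norm hσ hG, unit_ofUnit, unit_ofUnit, hx, hζ, hξ.eq_neg_one_of_two_right]

end GaloisUnits

/-! ### Power classes and translation of the abstract conditions. -/

/-- The power classes of `K`, on which `X` acts as `σ`. -/
def GaloisClasses (p : ℕ) {F K : Type*} [Field F] [Field K] [Algebra F K] (_ : K ≃ₐ[F] K) :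
    Type _ :=
  PowerClasses p K

namespace GaloisClasses

variable (p : ℕ) {F K : Type*} [Field F] [Field K] [Algebra F K] (σ : K ≃ₐ[F] K)

instance : AddCommGroup (GaloisClasses p σ) := inferInstanceAs (AddCommGroup (PowerClasses p K))

instance : Module (ZMod p) (GaloisClasses p σ) :=
  inferInstanceAs (Module (ZMod p) (PowerClasses p K))

/-- The identity map from the power classes. -/
def of : PowerClasses p K ≃ₗ[ZMod p] GaloisClasses p σ := LinearEquiv.refl _ (PowerClasses p K)

/-- The action of `σ`. -/
def frob : Module.End (ZMod p) (GaloisClasses p σ) :=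
  (of p σ).conj (PowerClasses.galRep p F K σ)

noncomputable instance : Module ℤ[X] (GaloisClasses p σ) :=
  Module.compHom _ (aeval (R := ℤ) (frob p σ)).toRingHom

theorem X_smul (y : PowerClasses p K) :
    (X : ℤ[X]) • of p σ y = of p σ (PowerClasses.galRep p F K σ y) := by
  change aeval (R := ℤ) (frob p σ) X (of p σ y) = _
  rw [aeval_X]
  rfl

/-- The reduction of the multiplicative group modulo `p`-th powers. -/
noncomputable def reduction : GaloisUnits σ →ₗ[ℤ[X]] GaloisClasses p σ where
  toFun a := of p σ (PowerClasses.mk p (GaloisUnits.unit a))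
  map_add' a b := map_add (PowerClasses.mkHom p K) a b
  map_smul' f a := by
    let g : GaloisUnits σ →+ GaloisClasses p σ := PowerClasses.mkHom p K
    change g (f • a) = f • g a
    have hX : ∀ a, g ((X : ℤ[X]) • a) = (X : ℤ[X]) • g a := by
      intro a
      refine Eq.trans ?_ (X_smul p σ _).symm
      refine Eq.trans ?_ (PowerClasses.galMap_mk p σ (GaloisUnits.unit a)).symm
      exact congrArg (PowerClasses.mk p) (Units.ext (GaloisUnits.coe_unit_X_smul a))
    induction f using Polynomial.induction_on generalizing a with
    | C c =>
      rw [show (C c : ℤ[X]) = (c : ℤ[X]) by simp, Int.cast_smul_eq_zsmul, Int.cast_smul_eq_zsmul,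
        map_zsmul]
    | add q r hq hr => rw [add_smul, add_smul, map_add, hq, hr]
    | monomial r c ih =>
      rw [pow_succ, ← mul_assoc, mul_smul, mul_smul _ X, ih, hX]

theorem reduction_ofUnit (u : Kˣ) :
    reduction p σ (GaloisUnits.ofUnit σ u) = of p σ (PowerClasses.mk p u) := rfl

theorem isModP : IsModP p (reduction p σ) where
  surjective y := by
    obtain ⟨u, hu⟩ := PowerClasses.exists_mk y
    exact ⟨GaloisUnits.ofUnit σ u, hu⟩
  eq_zero_iff a := by
    refine (PowerClasses.mk_eq_zero_iff (GaloisUnits.unit a)).trans ?_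
    exact Iff.rfl

/-- The nilpotent endomorphism `σ - 1` of the power classes. -/
noncomputable def diff (σ : K ≃ₐ[F] K) : Module.End (ZMod p) (PowerClasses p K) :=
  PowerClasses.galRep p F K σ - 1

theorem of_diff (y : PowerClasses p K) : of p σ (diff p σ y) = (X - 1 : ℤ[X]) • of p σ y := by
  rw [sub_smul, one_smul, X_smul, ← map_sub]
  rfl

theorem X_pow_smul (r : ℕ) (y : PowerClasses p K) :
    (X : ℤ[X]) ^ r • of p σ y = of p σ (PowerClasses.galRep p F K (σ ^ r) y) := by
  induction r with
  | zero => rw [pow_zero, pow_zero, one_smul, map_one]; rfl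
  | succ r ih => rw [pow_succ', mul_smul, ih, pow_succ', map_mul, X_smul]; rfl

theorem of_diff_pow (r : ℕ) (y : PowerClasses p K) :
    of p σ ((diff p σ ^ r) y) = (X - 1 : ℤ[X]) ^ r • of p σ y := by
  induction r generalizing y with
  | zero => rw [pow_zero, pow_zero, one_smul]; rfl
  | succ r ih => rw [pow_succ, pow_succ, mul_smul, ← of_diff, ← ih]; rfl

theorem diff_pow_pow [Fact p.Prime] (i : ℕ) :
    diff p σ ^ p ^ i = PowerClasses.galRep p F K (σ ^ p ^ i) - 1 := by
  ext y
  apply (of p σ).injective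
  rw [of_diff_pow, ← X_pow_sub_one_smul (isModP p σ).nsmul_eq_zero, sub_smul, one_smul, X_pow_smul,
    ← map_sub]
  rfl

variable {p σ} {n : ℕ} [FiniteDimensional F K] [IsGalois F K]
  (hp : p.Prime) (hσ : ∀ τ : K ≃ₐ[F] K, τ ∈ Subgroup.zpowers σ)
  (hG : Nat.card (K ≃ₐ[F] K) = p ^ n) (E : ℕ → IntermediateField F K)
  (hE : ∀ i ≤ n, Module.finrank F (E i) = p ^ i)

include hp hσ hG hE

theorem mem_ofField_iff {i : ℕ} (hi : i ≤ n) (y : PowerClasses p K) :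
    y ∈ PowerClasses.ofField p (E i) ↔
      of p σ y ∈ (levelSubmodule p (GaloisUnits σ) i).map (reduction p σ) := by
  have key := fun a => GaloisUnits.mem_levelSubmodule_iff_mem hp hσ hG hi (hE i hi) (a := a)
  rw [PowerClasses.mem_ofField_iff]
  constructor
  · rintro ⟨e, rfl⟩
    exact ⟨GaloisUnits.ofUnit σ (Units.map ((E i).val : E i →* K) e), (key _).2 e.1.2, rfl⟩
  · rintro ⟨a, ha, rfl⟩
    refine ⟨Units.mk0 ⟨(GaloisUnits.unit a : K), (key a).1 ha⟩ ?_, ?_⟩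
    · exact fun h0 => (GaloisUnits.unit a).ne_zero (congrArg Subtype.val h0)
    · exact congrArg (PowerClasses.mk p) (Units.ext rfl)

theorem mem_ofTower_iff {i : WithBot ℕ} (hi : i ≤ n) (y : PowerClasses p K) :
    y ∈ PowerClasses.ofTower p E i ↔ of p σ y ∈ levelImage p (reduction p σ) i := by
  cases i with
  | bot => exact Iff.rfl
  | coe i => exact mem_ofField_iff hp hσ hG E hE (WithBot.coe_le_coe.1 hi) y

omit hp hE in
theorem normClass_eq_zero_iff (δ : Kˣ) :
    PowerClasses.normClass p F δ = 0 ↔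
      GaloisUnits.ofUnit σ δ ∈ trivialNormSubmodule p n (GaloisUnits σ) := by
  rw [mem_trivialNormSubmodule]
  refine (PowerClasses.mk_eq_zero_iff _).trans ?_
  constructor
  · rintro ⟨c, hc⟩
    refine ⟨GaloisUnits.ofUnit σ (Units.map (algebraMap F K : F →* K) c),
      (GaloisUnits.mem_levelSubmodule_zero_iff hσ).2 ⟨c, rfl⟩, GaloisUnits.ext ?_⟩
    rw [GaloisUnits.unit_normPoly_eq_norm hσ hG, GaloisUnits.unit_nsmul, GaloisUnits.unit_ofUnit,
      GaloisUnits.unit_ofUnit, Units.val_pow_eq_pow_val]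
    change algebraMap F K c ^ p = _
    rw [← map_pow, ← Units.val_pow_eq_pow_val, hc]
    rfl
  · rintro ⟨f, hf, hfδ⟩
    obtain ⟨c, hc⟩ := (GaloisUnits.mem_levelSubmodule_zero_iff hσ).1 hf
    refine ⟨c, Units.ext ((algebraMap F K).injective ?_)⟩
    have := congrArg (fun a => (GaloisUnits.unit a : K)) hfδ
    simp only [GaloisUnits.unit_normPoly_eq_norm hσ hG, GaloisUnits.unit_nsmul,
      GaloisUnits.unit_ofUnit, Units.val_pow_eq_pow_val] at this
    rw [Units.val_pow_eq_pow_val, map_pow, hc, this]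
    rfl

/-- Testing τ = σ suffices: σ^r - 1 is a multiple of σ - 1, and level images are stable under σ. -/
theorem isAdmissible_iff {i : WithBot ℕ} (hi : i ≤ n) (δ : Kˣ) :
    PowerClasses.IsAdmissible p E i δ ↔
      IsNormAdmissible p n (reduction p σ) i (GaloisUnits.ofUnit σ δ) := by
  have hsm : ∀ r : ℕ, of p σ
      ((MonoidAlgebra.of (ZMod p) (K ≃ₐ[F] K) (σ ^ r) - 1) • PowerClasses.mk p δ) =
      (X ^ r - 1 : ℤ[X]) • reduction p σ (GaloisUnits.ofUnit σ δ) := by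
    intro r
    rw [sub_smul, sub_smul, one_smul, one_smul, reduction_ofUnit, X_pow_smul,
      PowerClasses.groupAlgebra_smul_def, Representation.asAlgebraHom_of, map_sub]
  refine and_congr (not_congr (normClass_eq_zero_iff hσ hG δ)) ⟨fun h => ?_, fun h τ => ?_⟩
  · have h1 := (mem_ofTower_iff hp hσ hG E hE hi _).1 (h (σ ^ 1))
    rw [hsm 1, pow_one] at h1
    exact h1
  · obtain ⟨r, rfl⟩ := (mem_powers_iff_mem_zpowers (x := σ)).2 (hσ τ)
    refine (mem_ofTower_iff hp hσ hG E hE hi _).2 ?_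
    change of p σ ((MonoidAlgebra.of (ZMod p) (K ≃ₐ[F] K) (σ ^ r) - 1) • _) ∈ _
    rw [hsm r, ← geom_sum_mul, mul_smul]
    exact Submodule.smul_mem _ _ h

theorem isLeast_of_isLeast_indexSet {m : WithBot ℕ} (hm : IsLeast (PowerClasses.indexSet p n E) m) :
    IsLeast {i : WithBot ℕ | i ≤ n ∧ ∃ d, IsNormAdmissible p n (reduction p σ) i d} m := by
  have hset : PowerClasses.indexSet p n E =
      {i : WithBot ℕ | i ≤ n ∧ ∃ d, IsNormAdmissible p n (reduction p σ) i d} := by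
    ext i
    refine and_congr_right fun hi => ?_
    exact exists_congr fun δ => isAdmissible_iff hp hσ hG E hE hi δ
  rwa [hset] at hm

theorem diff_pow_mem_ofField {i : ℕ} (hi : i ≤ n) (r : ℕ) {y : PowerClasses p K}
    (hy : y ∈ PowerClasses.ofField p (E i)) :
    (diff p σ ^ r) y ∈ PowerClasses.ofField p (E i) := by
  rw [mem_ofField_iff hp hσ hG E hE hi] at hy ⊢
  rw [of_diff_pow]
  exact Submodule.smul_mem _ _ hy

theorem diff_pow_sub_mem_ofField {i k : ℕ} (hik : i ≤ k) (hk : k ≤ n) {y : PowerClasses p K}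
    (hy : y ∈ PowerClasses.ofField p (E k)) :
    (diff p σ ^ (p ^ k - p ^ i)) y ∈ PowerClasses.ofField p (E i) := by
  have : Fact p.Prime := ⟨hp⟩
  rw [mem_ofField_iff hp hσ hG E hE hk] at hy
  rw [mem_ofField_iff hp hσ hG E hE (hik.trans hk)]
  obtain ⟨t, ht, hty⟩ := hy
  rw [of_diff_pow, ← hty, ← normPoly_smul (isModP p σ).nsmul_eq_zero hik]
  exact ⟨_, normPoly_smul_mem hik ht, map_smul _ _ _⟩

theorem ofField_mono {i k : ℕ} (hik : i ≤ k) (hk : k ≤ n) :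
    PowerClasses.ofField p (E i) ≤ PowerClasses.ofField p (E k) := by
  intro y hy
  rw [mem_ofField_iff hp hσ hG E hE (hik.trans hk)] at hy
  rw [mem_ofField_iff hp hσ hG E hE hk]
  exact Submodule.map_mono (levelSubmodule_mono hik) hy

end GaloisClasses

/-! ### Group algebra submodules spanned by Jordan strings. -/

section StringSubmodule

variable {p : ℕ} {F K : Type*} [Field F] [Field K] [Algebra F K] {σ : K ≃ₐ[F] K}

open GaloisClasses

theorem of_sub_one_smul (y : PowerClasses p K) :
    (MonoidAlgebra.of (ZMod p) (K ≃ₐ[F] K) σ - 1) • y = diff p σ y := by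
  rw [sub_smul, one_smul, PowerClasses.groupAlgebra_smul_def, Representation.asAlgebraHom_of]
  rfl

theorem diff_mem (Y : Submodule (MonoidAlgebra (ZMod p) (K ≃ₐ[F] K)) (PowerClasses p K))
    {y : PowerClasses p K} (hy : y ∈ Y) : diff p σ y ∈ Y := by
  rw [← of_sub_one_smul]
  exact Y.smul_mem _ hy

theorem diff_pow_mem (Y : Submodule (MonoidAlgebra (ZMod p) (K ≃ₐ[F] K)) (PowerClasses p K))
    {y : PowerClasses p K} (hy : y ∈ Y) (r : ℕ) : (diff p σ ^ r) y ∈ Y := by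
  induction r with
  | zero => exact hy
  | succ r ih => rw [pow_succ']; exact diff_mem Y ih

theorem galRep_mem (Y : Submodule (MonoidAlgebra (ZMod p) (K ≃ₐ[F] K)) (PowerClasses p K))
    {y : PowerClasses p K} (hy : y ∈ Y) (τ : K ≃ₐ[F] K) : PowerClasses.galRep p F K τ y ∈ Y := by
  have := Y.smul_mem (MonoidAlgebra.of (ZMod p) (K ≃ₐ[F] K) τ) hy
  rwa [PowerClasses.groupAlgebra_smul_def, Representation.asAlgebraHom_of] at this

/-- A subspace stable under `σ - 1` as a submodule over the group algebra. -/
noncomputable def invariantSubmodule [FiniteDimensional F K]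
    (hσ : ∀ τ : K ≃ₐ[F] K, τ ∈ Subgroup.zpowers σ)
    (W : Submodule (ZMod p) (PowerClasses p K)) (hW : ∀ w ∈ W, diff p σ w ∈ W) :
    Submodule (MonoidAlgebra (ZMod p) (K ≃ₐ[F] K)) (PowerClasses p K) where
  carrier := W
  zero_mem' := W.zero_mem
  add_mem' := W.add_mem
  smul_mem' a y hy := by
    have h1 : ∀ w ∈ W, PowerClasses.galRep p F K σ w ∈ W := fun w hw => by
      have := W.add_mem (hW w hw) hw
      rwa [diff, LinearMap.sub_apply, Module.End.one_apply, sub_add_cancel] at this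
    induction a using MonoidAlgebra.induction_on with
    | of τ =>
      obtain ⟨r, rfl⟩ := (mem_powers_iff_mem_zpowers (x := σ)).2 (hσ τ)
      rw [PowerClasses.groupAlgebra_smul_def, Representation.asAlgebraHom_of]
      change PowerClasses.galRep p F K (σ ^ r) y ∈ W
      induction r with
      | zero => rw [pow_zero, map_one]; exact hy
      | succ r ih => rw [pow_succ', map_mul]; exact h1 _ ih
    | add a b ha hb => rw [add_smul]; exact W.add_mem ha hb
    | smul c a ha => rw [smul_assoc]; exact W.smul_mem c ha

variable [Fact p.Prime] [FiniteDimensional F K] (hσ : ∀ τ : K ≃ₐ[F] K, τ ∈ Subgroup.zpowers σ)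
  {B : Type*} {x : B → PowerClasses p K} {l : B → ℕ} (hx : ∀ b, (diff p σ ^ l b) (x b) = 0)

/-- The submodule spanned by the Jordan strings with index in `P`. -/
noncomputable def stringSubmodule (P : Set B) :
    Submodule (MonoidAlgebra (ZMod p) (K ≃ₐ[F] K)) (PowerClasses p K) :=
  invariantSubmodule hσ
    (Submodule.span (ZMod p) (jordanString (diff p σ) x l '' {z | z.1 ∈ P})) (by
      intro w hw
      refine Submodule.span_induction ?_ ?_ ?_ ?_ hw
      · rintro _ ⟨⟨b, j⟩, hb, rfl⟩
        have h1 : diff p σ (jordanString (diff p σ) x l ⟨b, j⟩) =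
            (diff p σ ^ ((j : ℕ) + 1)) (x b) := by rw [pow_succ']; rfl
        rw [h1]
        by_cases hj : (j : ℕ) + 1 < l b
        · exact Submodule.subset_span ⟨⟨b, ⟨j + 1, hj⟩⟩, hb, rfl⟩
        · rw [pow_apply_eq_zero_of_le (hx b) (by omega)]
          exact zero_mem _
      · rw [map_zero]; exact zero_mem _
      · intro a b _ _ ha hb
        rw [map_add]; exact add_mem ha hb
      · intro c a _ ha
        rw [map_smul]; exact Submodule.smul_mem _ c ha)

theorem mem_stringSubmodule {P : Set B} {y : PowerClasses p K} :
    y ∈ stringSubmodule hσ hx P ↔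
      y ∈ Submodule.span (ZMod p) (jordanString (diff p σ) x l '' {z | z.1 ∈ P}) := Iff.rfl

theorem stringSubmodule_mono {P Q : Set B} (h : P ⊆ Q) :
    stringSubmodule hσ hx P ≤ stringSubmodule hσ hx Q := by
  have h1 : {z : Σ b, Fin (l b) | z.1 ∈ P} ⊆ {z | z.1 ∈ Q} := fun z hz => h hz
  intro y hy
  rw [mem_stringSubmodule] at hy ⊢
  exact Submodule.span_mono (Set.image_mono h1) hy

theorem stringSubmodule_le {P : Set B}
    {Y : Submodule (MonoidAlgebra (ZMod p) (K ≃ₐ[F] K)) (PowerClasses p K)}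
    (h : ∀ b ∈ P, x b ∈ Y) : stringSubmodule hσ hx P ≤ Y := by
  intro y hy
  have : Submodule.span (ZMod p) (jordanString (diff p σ) x l '' {z | z.1 ∈ P}) ≤
      Y.restrictScalars (ZMod p) := by
    rw [Submodule.span_le]
    rintro _ ⟨⟨b, j⟩, hb, rfl⟩
    exact diff_pow_mem Y (h b hb) j
  exact this hy

theorem apply_mem_stringSubmodule {P : Set B} {b : B} (hb : b ∈ P) :
    x b ∈ stringSubmodule hσ hx P := by
  rcases Nat.eq_zero_or_pos (l b) with h0 | h0
  · have := hx b
    rw [h0, pow_zero, Module.End.one_apply] at this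
    rw [this]
    exact zero_mem _
  · exact Submodule.subset_span ⟨⟨b, ⟨0, h0⟩⟩, hb, rfl⟩

theorem stringSubmodule_singleton (b : B) :
    stringSubmodule hσ hx {b} =
      Submodule.span (MonoidAlgebra (ZMod p) (K ≃ₐ[F] K)) {x b} := by
  apply le_antisymm
  · refine stringSubmodule_le hσ hx ?_
    rintro _ rfl
    exact Submodule.mem_span_singleton_self _
  · rw [Submodule.span_singleton_le_iff_mem]
    exact apply_mem_stringSubmodule hσ hx rfl

theorem iSup_stringSubmodule {ι : Sort*} (P : ι → Set B) :
    ⨆ i, stringSubmodule hσ hx (P i) = stringSubmodule hσ hx (⋃ i, P i) := by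
  apply le_antisymm
  · exact iSup_le fun i => stringSubmodule_mono hσ hx (Set.subset_iUnion P i)
  · refine stringSubmodule_le hσ hx fun b hb => ?_
    obtain ⟨i, hi⟩ := Set.mem_iUnion.1 hb
    exact Submodule.mem_iSup_of_mem i (apply_mem_stringSubmodule hσ hx hi)

variable (hli : LinearIndependent (ZMod p) (jordanString (diff p σ) x l))

include hli

theorem disjoint_stringSubmodule {P Q : Set B} (h : Disjoint P Q) :
    Disjoint (stringSubmodule hσ hx P) (stringSubmodule hσ hx Q) := by
  have h1 : Disjoint {z : Σ b, Fin (l b) | z.1 ∈ P} {z | z.1 ∈ Q} := by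
    rw [Set.disjoint_left] at h ⊢
    exact fun z hz => h hz
  rw [Submodule.disjoint_def]
  intro y hy hy'
  rw [mem_stringSubmodule] at hy hy'
  exact Submodule.disjoint_def.1 (hli.disjoint_span_image h1) y hy hy'

theorem iSupIndep_stringSubmodule {ι : Type*} {P : ι → Set B} (h : Pairwise (Function.onFun Disjoint P)) :
    iSupIndep fun i => stringSubmodule hσ hx (P i) := by
  intro i
  refine (disjoint_stringSubmodule hσ hx hli (Q := ⋃ j, ⋃ _ : j ≠ i, P j) ?_).mono_right ?_
  · rw [Set.disjoint_iUnion_right]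
    intro j
    rw [Set.disjoint_iUnion_right]
    exact fun hj => h hj.symm
  · exact iSup₂_le fun j hj => stringSubmodule_mono hσ hx
      (Set.subset_iUnion₂ (s := fun j (_ : j ≠ i) => P j) j hj)

theorem finrank_stringSubmodule_singleton (b : B) :
    Module.finrank (ZMod p) (stringSubmodule hσ hx {b}) = l b := by
  have hinj : Function.Injective fun j : Fin (l b) => (⟨b, j⟩ : Σ b, Fin (l b)) :=
    fun j j' h => by simpa using h
  have h1 := finrank_span_eq_card (hli.comp _ hinj)
  rw [Fintype.card_fin] at h1
  rw [← h1]
  have h2 : Set.range (jordanString (diff p σ) x l ∘ fun j : Fin (l b) => ⟨b, j⟩) =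
      jordanString (diff p σ) x l '' {z | z.1 ∈ ({b} : Set B)} := by
    ext w
    constructor
    · rintro ⟨j, rfl⟩
      exact ⟨⟨b, j⟩, rfl, rfl⟩
    · rintro ⟨⟨_, j⟩, rfl, rfl⟩
      exact ⟨j, rfl⟩
  rw [h2]
  rfl

theorem isSumOfCyclics_stringSubmodule {P : Set B} {r : ℕ}
    (hP : ∀ b ∈ P, l b = r) : PowerClasses.IsSumOfCyclics r (stringSubmodule hσ hx P) := by
  refine ⟨Set.range fun b : P => stringSubmodule hσ hx {b.1}, ?_, ?_, ?_⟩
  · rintro _ ⟨b, rfl⟩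
    exact ⟨⟨x b, stringSubmodule_singleton hσ hx b.1⟩,
      (finrank_stringSubmodule_singleton hσ hx hli b.1).trans (hP b b.2)⟩
  · refine (iSupIndep_stringSubmodule hσ hx hli ?_).sSupIndep_range
    intro b b' hbb
    exact Set.disjoint_singleton.2 fun h => hbb (Subtype.ext h)
  · rw [sSup_range, iSup_stringSubmodule, Set.iUnion_subtype]
    congr 1
    exact Set.biUnion_of_singleton P

end StringSubmodule

/-! ### The Jordan basis of the power classes and the final decomposition. -/

namespace GaloisClasses

variable {p : ℕ} {F K : Type*} [Field F] [Field K] [Algebra F K] {σ : K ≃ₐ[F] K} {n : ℕ}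
  [hp : Fact p.Prime] [FiniteDimensional F K] [IsGalois F K]
  (hσ : ∀ τ : K ≃ₐ[F] K, τ ∈ Subgroup.zpowers σ)
  (hG : Nat.card (K ≃ₐ[F] K) = p ^ n) (E : ℕ → IntermediateField F K)
  (hE : ∀ i ≤ n, Module.finrank F (E i) = p ^ i) {ξ : GaloisUnits σ}
  (hξ : IsKummerTower p n ξ) {m : WithBot ℕ} (hm : IsLeast (PowerClasses.indexSet p n E) m)
  {δ : Kˣ} (hδ : PowerClasses.IsAdmissible p E m δ)

include hσ hG hE hξ hδ

theorem smul_eq_zero_of_add_mem_ofField (hmn : m ≤ n) {i : ℕ} (hi : i < n) {c : ZMod p}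
    {y : PowerClasses p K}
    (hy : c • PowerClasses.mk p δ + diff p σ y ∈ PowerClasses.ofField p (E i)) : c = 0 := by
  rw [mem_ofField_iff hp.out hσ hG E hE hi.le, map_add, of_diff, map_smul,
    ← reduction_ofUnit] at hy
  exact hξ.smul_eq_zero_of_add_mem_levelImage (isModP p σ)
    ((isAdmissible_iff hp.out hσ hG E hE hmn δ).1 hδ) hi hy

include hm

omit hδ in
theorem index_lt : m < n :=
  hξ.lt_of_isLeast (isModP p σ) (isLeast_of_isLeast_indexSet hp.out hσ hG E hE hm)

theorem exists_jordanBasis :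
    ∃ (S : Set (PowerClasses p K)) (o : S) (lv : S → ℕ) (x : S → PowerClasses p K) (l : S → ℕ),
      x o = PowerClasses.mk p δ ∧ l o = PowerClasses.powBot p m + 1 ∧
      (∀ b, b ≠ o → lv b ≤ n ∧ l b = p ^ lv b ∧ x b ∈ PowerClasses.ofField p (E (lv b))) ∧
      (∀ b, (diff p σ ^ l b) (x b) = 0) ∧
      LinearIndependent (ZMod p) (jordanString (diff p σ) x l) ∧
      Submodule.span (ZMod p) (Set.range (jordanString (diff p σ) x l)) = ⊤ := by
  obtain ⟨S, o, lv, x, l, h1, h2, h3, h4, h5, h6⟩ :=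
    hξ.exists_jordanBasis (isModP p σ) (isLeast_of_isLeast_indexSet hp.out hσ hG E hE hm)
      ((isAdmissible_iff hp.out hσ hG E hE hm.1.1 δ).1 hδ) (N := diff p σ) (of_diff p σ)
  refine ⟨S, o, lv, x, l, h1, h2, fun b hb => ?_, h4, h5, h6⟩
  obtain ⟨h7, h8, h9⟩ := h3 b hb
  exact ⟨h7, h8, (mem_ofField_iff hp.out hσ hG E hE h7 _).2 h9⟩

end GaloisClasses

theorem galRep_eq_self_of_mem_ofField {p : ℕ} {F K : Type*} [Field F] [Field K] [Algebra F K]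
    {E : IntermediateField F K} {τ : K ≃ₐ[F] K} (hτ : τ ∈ E.fixingSubgroup) {y : PowerClasses p K}
    (hy : y ∈ PowerClasses.ofField p E) : PowerClasses.galRep p F K τ y = y := by
  obtain ⟨e, rfl⟩ := (PowerClasses.mem_ofField_iff _ _).1 hy
  refine (PowerClasses.galMap_mk p τ _).trans (congrArg (PowerClasses.mk p) (Units.ext ?_))
  exact (IntermediateField.mem_fixingSubgroup_iff _ _).1 hτ _ e.1.2

/-- Classes from E are fixed by its group, and both summands are G-stable, so the Y-component of
such a class is fixed too. By `hY` that component comes from E, hence so does the X-component. -/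
theorem ofField_eq_image_sup_fixedPart {p : ℕ} [Fact p.Prime] {F K : Type*} [Field F] [Field K]
    [Algebra F K] {σ : K ≃ₐ[F] K} {E : IntermediateField F K} {i r : ℕ}
    (hσE : σ ^ p ^ i ∈ E.fixingSubgroup)
    {X Y : Submodule (MonoidAlgebra (ZMod p) (K ≃ₐ[F] K)) (PowerClasses p K)} (hXY : IsCompl X Y)
    {a : MonoidAlgebra (ZMod p) (K ≃ₐ[F] K)}
    (ha : (PowerClasses.galRep p F K).asAlgebraHom a = GaloisClasses.diff p σ ^ r)
    (hX : ∀ x ∈ X, (GaloisClasses.diff p σ ^ r) x ∈ PowerClasses.ofField p E)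
    (hX' : ∀ x ∈ X, x ∈ PowerClasses.ofField p E → ∃ x' ∈ X, (GaloisClasses.diff p σ ^ r) x' = x)
    (hY : ∀ y ∈ Y, (GaloisClasses.diff p σ ^ p ^ i) y = 0 → y ∈ PowerClasses.ofField p E) :
    Disjoint (PowerClasses.image a X) (PowerClasses.fixedPart E.fixingSubgroup Y) ∧
      PowerClasses.ofField p E =
        PowerClasses.image a X ⊔ PowerClasses.fixedPart E.fixingSubgroup Y := by
  have himage : ∀ x, x ∈ PowerClasses.image a X ↔
      ∃ x' ∈ X, (GaloisClasses.diff p σ ^ r) x' = x := by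
    intro x
    rw [PowerClasses.image, ha, Submodule.mem_map]
    rfl
  have hYE : PowerClasses.fixedPart E.fixingSubgroup Y ≤ PowerClasses.ofField p E := by
    rintro y ⟨hy, hfix⟩
    refine hY y hy ?_
    rw [GaloisClasses.diff_pow_pow, LinearMap.sub_apply, hfix _ hσE, Module.End.one_apply, sub_self]
  have hdis := Submodule.disjoint_def.1 hXY.disjoint
  refine ⟨?_, le_antisymm ?_ (sup_le ?_ hYE)⟩
  · rw [Submodule.disjoint_def]
    intro x hx hy
    obtain ⟨x', hx', rfl⟩ := (himage x).1 hx
    exact hdis _ (diff_pow_mem X hx' r) hy.1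
  · intro t ht
    obtain ⟨x, hx, y, hy, rfl⟩ := Submodule.mem_sup.1
      (hXY.sup_eq_top.symm ▸ Submodule.mem_top : t ∈ X ⊔ Y)
    have hyfix : y ∈ PowerClasses.fixedPart E.fixingSubgroup Y := by
      refine ⟨hy, fun τ hτ => ?_⟩
      have h1 := galRep_eq_self_of_mem_ofField hτ ht
      rw [map_add] at h1
      have h2 : PowerClasses.galRep p F K τ y - y = x - PowerClasses.galRep p F K τ x := by
        rw [sub_eq_sub_iff_add_eq_add, add_comm, h1]
      refine sub_eq_zero.1 (hdis _ ?_ (sub_mem (galRep_mem Y hy τ) hy))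
      rw [h2]
      exact sub_mem hx (galRep_mem X hx τ)
    refine Submodule.add_mem_sup ((himage x).2 (hX' x hx ?_)) hyfix
    have h3 := sub_mem ht (hYE hyfix)
    rwa [add_sub_cancel_right] at h3
  · intro x hx
    obtain ⟨x', hx', rfl⟩ := (himage x).1 hx
    exact hX x' hx'

theorem theorem2 (p n : ℕ) (hp : p.Prime) (hn : 1 ≤ n)
    (F K : Type*) [Field F] [Field K] [Algebra F K] [FiniteDimensional F K] [IsGalois F K]
    (σ : K ≃ₐ[F] K) (hσ : ∀ τ : K ≃ₐ[F] K, τ ∈ Subgroup.zpowers σ)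
    (hG : Nat.card (K ≃ₐ[F] K) = p ^ n)
    -- `E i` is the intermediate field of degree `p ^ i`
    (E : ℕ → IntermediateField F K) (hE : ∀ i ≤ n, Module.finrank F (E i) = p ^ i)
    (hξ : ∃ ξ : F, IsPrimitiveRoot ξ p)
    (h2 : p = 2 → 1 < n ∨ ∃ x : Kˣ, Algebra.norm F (x : K) = -1)
    -- `m = i(K/F)`
    (m : WithBot ℕ) (hm : IsLeast (PowerClasses.indexSet p n E) m)
    (δ : Kˣ) (hδ : PowerClasses.IsExceptional p n E δ) :
    ∃ (X Y : Submodule (MonoidAlgebra (ZMod p) (K ≃ₐ[F] K)) (PowerClasses p K))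
      (Ys : Fin (n + 1) →
        Submodule (MonoidAlgebra (ZMod p) (K ≃ₐ[F] K)) (PowerClasses p K)),
      IsCompl X Y ∧ iSupIndep Ys ∧ Y = ⨆ i, Ys i ∧
      X = Submodule.span (MonoidAlgebra (ZMod p) (K ≃ₐ[F] K)) {PowerClasses.mk p δ} ∧
      Module.finrank (ZMod p) X = PowerClasses.powBot p m + 1 ∧
      (∀ i : Fin (n + 1), PowerClasses.IsSumOfCyclics (p ^ (i : ℕ)) (Ys i)) ∧
      ∀ i : ℕ, i < n →
        (m ≤ (i : WithBot ℕ) →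
          Disjoint
            (PowerClasses.image (MonoidAlgebra.of (ZMod p) (K ≃ₐ[F] K) σ - 1) X)
            (PowerClasses.fixedPart (E i).fixingSubgroup Y) ∧
          PowerClasses.ofField p (E i) =
            PowerClasses.image (MonoidAlgebra.of (ZMod p) (K ≃ₐ[F] K) σ - 1) X ⊔
            PowerClasses.fixedPart (E i).fixingSubgroup Y) ∧
        (∀ k : ℕ, m = (k : WithBot ℕ) → i < k →
          Disjoint
            (PowerClasses.image ((MonoidAlgebra.of (ZMod p) (K ≃ₐ[F] K) σ - 1) *
              (MonoidAlgebra.of (ZMod p) (K ≃ₐ[F] K) (σ ^ p ^ i) - 1) ^ (p ^ (k - i) - 1)) X)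
            (PowerClasses.fixedPart (E i).fixingSubgroup Y) ∧
          PowerClasses.ofField p (E i) =
            PowerClasses.image ((MonoidAlgebra.of (ZMod p) (K ≃ₐ[F] K) σ - 1) *
              (MonoidAlgebra.of (ZMod p) (K ≃ₐ[F] K) (σ ^ p ^ i) - 1) ^ (p ^ (k - i) - 1)) X ⊔
            PowerClasses.fixedPart (E i).fixingSubgroup Y) := by
  have hpF : Fact p.Prime := ⟨hp⟩
  obtain ⟨m', hm', hδ⟩ := hδ
  obtain rfl := hm.unique hm'
  obtain ⟨ξ, hξ⟩ := hξ
  have hξ0 : algebraMap F K ξ ≠ 0 := (_root_.map_ne_zero _).2 (hξ.ne_zero hp.ne_zero)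
  have hT := GaloisUnits.isKummerTower hp hn hσ hG E hE hξ h2 (ζ := Units.mk0 _ hξ0) rfl
  have hmn : m < n := GaloisClasses.index_lt hσ hG E hE hT hm
  obtain ⟨S, o, lv, x, l, hxo, hlo, hb, hx, hli, hsp⟩ :=
    GaloisClasses.exists_jordanBasis hσ hG E hE hT hm hδ
  set N := GaloisClasses.diff p σ with hN
  let W := stringSubmodule hσ hx
  let P : Fin (n + 1) → Set S := fun i => {b | b ≠ o ∧ lv b = i}
  have hPY : ⋃ i, P i = {o}ᶜ := by
    ext b
    simp only [Set.mem_iUnion, Set.mem_compl_iff, Set.mem_singleton_iff]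
    exact ⟨fun ⟨i, hi⟩ => hi.1, fun h => ⟨⟨lv b, Nat.lt_succ_iff.2 (hb b h).1⟩, h, rfl⟩⟩
  have hWtop : W Set.univ = ⊤ := by
    rw [eq_top_iff]
    intro y _
    have h1 : y ∈ Submodule.span (ZMod p) (Set.range (jordanString N x l)) :=
      hsp ▸ Submodule.mem_top
    rw [mem_stringSubmodule]
    rw [← Set.image_univ] at h1
    exact Submodule.span_mono (Set.image_mono fun z _ => Set.mem_univ z.1) h1
  have hcompl : IsCompl (W {o}) (W {o}ᶜ) := by
    refine ⟨disjoint_stringSubmodule hσ hx hli disjoint_compl_right, codisjoint_iff_le_sup.2 ?_⟩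
    rw [← hWtop]
    refine stringSubmodule_le hσ hx fun b _ => ?_
    by_cases hbo : b = o
    · exact Submodule.mem_sup_left (apply_mem_stringSubmodule hσ hx hbo)
    · exact Submodule.mem_sup_right (apply_mem_stringSubmodule hσ hx hbo)
  have hxo_mem : PowerClasses.mk p δ ∈ W {o} := hxo ▸ apply_mem_stringSubmodule hσ hx rfl
  have hW_ind : ∀ (Q : Submodule (ZMod p) (PowerClasses p K)) (r : ℕ),
      (∀ j, (N ^ (j + r)) (PowerClasses.mk p δ) ∈ Q) → ∀ y ∈ W {o}, (N ^ r) y ∈ Q := by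
    intro Q r hQ y hy
    rw [mem_stringSubmodule] at hy
    have h1 : Submodule.span (ZMod p) (jordanString N x l '' {z | z.1 ∈ ({o} : Set S)}) ≤
        Q.comap (N ^ r) := by
      rw [Submodule.span_le]
      rintro _ ⟨⟨b, j⟩, rfl, rfl⟩
      rw [SetLike.mem_coe, Submodule.mem_comap, jordanString, hxo, ← Module.End.mul_apply,
        ← pow_add, add_comm]
      exact hQ j
    exact h1 hy
  have hY : ∀ i < n, ∀ y ∈ W {o}ᶜ, (N ^ p ^ i) y = 0 → y ∈ PowerClasses.ofField p (E i) := by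
    intro i hi y hy hNy
    rw [mem_stringSubmodule] at hy
    refine Submodule.span_le.2 ?_ (mem_span_jordanString_of_pow_apply_eq_zero hx hli hy hNy)
    rintro _ ⟨⟨b, j⟩, ⟨hbo, hbj⟩, rfl⟩
    obtain ⟨hlv, hlb, hxb⟩ := hb b hbo
    rw [SetLike.mem_coe, jordanString]
    rcases le_total (lv b) i with h1 | h1
    · exact GaloisClasses.diff_pow_mem_ofField hp hσ hG E hE hi.le _
        (GaloisClasses.ofField_mono hp hσ hG E hE h1 hi.le hxb)
    -- A string vector killed by N^(p^i) lies at least p^(lv b) - p^i steps down, and that power of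
    -- N is the norm from level lv b to level i.
    · have h3 : (j : ℕ) = (j - (p ^ lv b - p ^ i)) + (p ^ lv b - p ^ i) := by
        simp only at hbj
        omega
      rw [h3, pow_add, Module.End.mul_apply]
      exact GaloisClasses.diff_pow_mem_ofField hp hσ hG E hE hi.le _
        (GaloisClasses.diff_pow_sub_mem_ofField hp hσ hG E hE h1 hlv hxb)
  have hfix : ∀ i < n, σ ^ p ^ i ∈ (E i).fixingSubgroup := fun i hi =>
    (pow_mem_fixingSubgroup_iff hp hσ hG hi.le (hE i hi.le) _).2 dvd_rfl
  have hone : (PowerClasses.galRep p F K).asAlgebraHom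
      (MonoidAlgebra.of (ZMod p) (K ≃ₐ[F] K) σ - 1) = N := by
    rw [map_sub, map_one, Representation.asAlgebraHom_of]; rfl
  have hNδ : N (PowerClasses.mk p δ) ∈ PowerClasses.ofTower p E m := by
    rw [hN, ← of_sub_one_smul]
    exact hδ.2 σ
  refine ⟨W {o}, W {o}ᶜ, fun i => W (P i), hcompl, ?_, ?_, ?_, ?_, ?_, fun i hi => ⟨?_, ?_⟩⟩
  · refine iSupIndep_stringSubmodule hσ hx hli fun i j hij => ?_
    exact Set.disjoint_left.2 fun b hbi hbj => hij (Fin.ext (hbi.2.symm.trans hbj.2))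
  · rw [iSup_stringSubmodule, hPY]
  · rw [← hxo]
    exact stringSubmodule_singleton hσ hx o
  · rw [← hlo]
    exact finrank_stringSubmodule_singleton hσ hx hli o
  · intro i
    refine isSumOfCyclics_stringSubmodule hσ hx hli fun b hbP => ?_
    rw [(hb b hbP.1).2.1, hbP.2]
  · intro hmi
    have hNδi : N (PowerClasses.mk p δ) ∈ PowerClasses.ofField p (E i) := by
      cases m with
      | bot => rw [(show N (PowerClasses.mk p δ) = 0 from hNδ)]; exact zero_mem _
      | coe k =>
        exact GaloisClasses.ofField_mono hp hσ hG E hE (WithBot.coe_le_coe.1 hmi) hi.le hNδ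
    refine ofField_eq_image_sup_fixedPart (r := 1) (hfix i hi) hcompl (by rw [hone, pow_one]) ?_ ?_
      (hY i hi)
    · refine hW_ind _ 1 fun j => ?_
      rw [pow_succ, Module.End.mul_apply]
      exact GaloisClasses.diff_pow_mem_ofField hp hσ hG E hE hi.le j hNδi
    · intro y hy hyE
      -- X is spanned by [δ] and N X, and the norm class excludes [δ] from any element of [K_iˣ].
      let Q : Submodule (ZMod p) (PowerClasses p K) :=
        Submodule.span (ZMod p) {PowerClasses.mk p δ} ⊔
          ((W {o}).restrictScalars (ZMod p)).map N
      have hyQ : y ∈ Q := by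
        refine hW_ind Q 0 (fun j => ?_) y hy
        cases j with
        | zero => exact Submodule.mem_sup_left (Submodule.mem_span_singleton_self _)
        | succ j =>
          refine Submodule.mem_sup_right ⟨(N ^ j) (PowerClasses.mk p δ),
            diff_pow_mem _ hxo_mem j, ?_⟩
          rw [add_zero, pow_succ']
          rfl
      obtain ⟨u, hu, v, hv, rfl⟩ := Submodule.mem_sup.1 hyQ
      obtain ⟨c, rfl⟩ := Submodule.mem_span_singleton.1 hu
      obtain ⟨w, hw, rfl⟩ := hv
      have hc := GaloisClasses.smul_eq_zero_of_add_mem_ofField hσ hG E hE hT hδ hmn.le hi hyE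
      exact ⟨w, hw, by rw [hc, zero_smul, zero_add, pow_one]⟩
  · rintro k rfl hik
    have hkn : k < n := WithBot.coe_lt_coe.1 hmn
    have hpik : p ^ i < p ^ k := Nat.pow_lt_pow_right hp.one_lt hik
    -- The operator is N^(p^k - p^i + 1): one step brings [δ] into level k, and the rest is the norm
    -- from level k to level i.
    have hr : 1 + p ^ i * (p ^ (k - i) - 1) = (p ^ k - p ^ i) + 1 := by
      rw [Nat.mul_sub, ← pow_add, Nat.add_sub_cancel' hik.le, mul_one, add_comm]
    refine ofField_eq_image_sup_fixedPart (r := (p ^ k - p ^ i) + 1) (hfix i hi) hcompl ?_ ?_ ?_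
      (hY i hi)
    · rw [map_mul, hone, map_pow, map_sub, map_one, Representation.asAlgebraHom_of,
        ← GaloisClasses.diff_pow_pow, ← pow_mul, ← hN, ← hr, pow_add, pow_one]
    · refine hW_ind _ _ fun j => ?_
      rw [pow_add, pow_succ, Module.End.mul_apply, Module.End.mul_apply]
      exact GaloisClasses.diff_pow_mem_ofField hp hσ hG E hE hi.le j
        (GaloisClasses.diff_pow_sub_mem_ofField hp hσ hG E hE hik.le hkn.le hNδ)
    · intro y hy hyE
      have hNy : (N ^ p ^ i) y = 0 := by
        rw [hN, GaloisClasses.diff_pow_pow, LinearMap.sub_apply,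
          galRep_eq_self_of_mem_ofField (hfix i hi) hyE, Module.End.one_apply, sub_self]
      have hy' := mem_span_jordanString_of_pow_apply_eq_zero hx hli
        ((mem_stringSubmodule hσ hx).1 hy) hNy
      suffices Submodule.span (ZMod p) (jordanString N x l ''
          {z | z.1 ∈ ({o} : Set S) ∧ l z.1 ≤ z.2 + p ^ i}) ≤
          ((W {o}).restrictScalars (ZMod p)).map (N ^ ((p ^ k - p ^ i) + 1)) from this hy'
      rw [Submodule.span_le]
      rintro _ ⟨⟨b, j⟩, ⟨rfl, hj⟩, rfl⟩
      refine ⟨(N ^ (j - ((p ^ k - p ^ i) + 1))) (PowerClasses.mk p δ), diff_pow_mem _ hxo_mem _, ?_⟩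
      -- The string of δ has length p^k + 1, so being killed by N^(p^i) means lying at least p^k -
      -- p^i + 1 steps down.
      have hj' : p ^ k + 1 ≤ j + p ^ i := by
        simp only [hlo] at hj
        exact hj
      change _ = (N ^ (j : ℕ)) (x b)
      rw [hxo, ← Module.End.mul_apply, ← pow_add]
      congr 2
      omega
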